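/- **Setting.** For every value $\lambda\in\mathbb N$ of the security parameter let $\mathcal R:\{0,1\}^\lambda\to\{0,1\}$ be a uniformly random function (the secret random oracle). A zero-bit binary code in the secret random oracle model consists of randomized algorithms with oracle access to $\mathcal R$: $\mathsf{KeyGen}^{\mathcal R}$ outputs a key $\mathsf{sk}\in\{0,1\}^{\ell(\lambda)}$, where $\ell$ is bounded by a polynomial; $\mathsf{Enc}^{\mathcal R}(\mathsf{sk})$ outputs a codeword in $\{0,1\}^{n(\lambda)}$; and $\mathsf{Dec}^{\mathcal R}(\mathsf{sk},x)$ outputs $1$ or $\bot$ for $x\in\{0,1\}^{n(\lambda)}$. No bound on the running time of these algorithms is assumed. Let $\rho=\rho(\lambda)\in[0,1]$. The $\rho$-noise channel $\mathcal N_\rho$ maps $x$ to $x\oplus e$, where the bits of $e$ are independent and equal to $1$ with probability $(1-\rho)/2$. For real-valued functions $\delta,\varepsilon,\mu$ of $\lambda$, the code is a *$(\delta,\varepsilon,\mu)$ pseudorandom code robust to $\mathcal N_\rho$* if the following hold, with probabilities taken over $\mathcal R$ and all internal coins. * *Completeness.* For every $\lambda$, $\Pr[\mathsf{Dec}^{\mathcal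 R}(\mathsf{sk},\tilde c)=1]\ge 1-\delta$, where $\mathsf{sk}\leftarrow\mathsf{KeyGen}^{\mathcal R}$, $c\leftarrow\mathsf{Enc}^{\mathcal R}(\mathsf{sk})$ and $\tilde c\leftarrow\mathcal N_\rho(c)$. * *Soundness.* For every $\lambda$ and every fixed $x\in\{0,1\}^{n}$, $\Pr[\mathsf{Dec}^{\mathcal R}(\mathsf{sk},x)=\bot]\ge 1-\mu$, where $\mathsf{sk}\leftarrow\mathsf{KeyGen}^{\mathcal R}$. * *Statistical pseudorandomness.* For every polynomially bounded $m=m(\lambda)$ and every computationally unbounded adversary $\mathcal A$ without access to $\mathcal R$, for all sufficiently large $\lambda$, $$\bigl|\Pr[\mathcal A(c_1,\dots,c_m)=1]-\Pr[\mathcal A(u_1,\dots,u_m)=1]\bigr|\le\varepsilon(\lambda),$$ where $c_1,\dots,c_m$ are fresh outputs of $\mathsf{Enc}^{\mathcal R}(\mathsf{sk})$ for one $\mathcal R$ and one $\mathsf{sk}\leftarrow\mathsf{KeyGen}^{\mathcal R}$, and $u_1,\dots,u_m$ are independent and uniform on $\{0,1\}^n$. **Theorem.** There is an absolute constant $C>0$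 such that the following holds for every zero-bit $(\delta,\varepsilon,\mu)$ pseudorandom code in the secret random oracle model that is robust to the $\rho$-noise channel and in which one execution of each of $\mathsf{KeyGen}^{\mathcal R}$, $\mathsf{Enc}^{\mathcal R}$, $\mathsf{Dec}^{\mathcal R}$ makes at most $Q=Q(\lambda)\ge 1$ queries to $\mathcal R$. 1. There is a function $\eta:\mathbb N\to[0,\infty)$ with $\eta=\omega(1-\rho)$ as $\lambda\to\infty$ (that is, $1-\rho=o(\eta)$) such that for every $\lambda$ $$\delta+\mu\;\ge\;1-Q^2\cdot\lambda^{-\eta}-C\,Q^2\sqrt{\varepsilon n}.$$ That is, $\delta+\mu\ge 1-Q^2\lambda^{-\omega(1-\rho)}-O(Q^2\sqrt{\varepsilon n})$. (Here $0^0=1$, and $\sqrt{t}$ is read as $0$ for $t<0$.) 2. Consequently, if in addition $n$ and $Q$ are polynomially bounded, $\varepsilon$ is negligible, and the noise rate is at least constant (there is $r<1$ with $\rho(\lambda)\le r$ for all large $\lambda$), then there is no non-trivial completeness–soundness gap: $\delta+\mu\ge 1-\nu$ for every $\lambda$, for some negligible function $\nu$. -/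

import Mathlib

open Filter Asymptotics

noncomputable section

/-- Bit strings of length `n`. -/
abbrev BitString (n : ℕ) : Type := Fin n → Bool

/-- The set of all functions `R : {0,1}^κ → {0,1}`, from which the random oracle is drawn
uniformly. -/
abbrev Oracle (κ : ℕ) : Type := BitString κ → Bool

/-- A deterministic adaptive query algorithm with outputs in `α` and queries in `{0,1}^κ`: it either
stops with an output, or asks one query and continues depending on the answer bit. -/
inductive QueryAlg (κ : ℕ) (α : Type) : Type
  | ret (a : α) : QueryAlg κ α
  | ask (q : BitString κ) (next : Bool → QueryAlg κ α) : QueryAlg κ α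

namespace QueryAlg

/-- The output of the algorithm when its queries are answered by `R`. -/
def run {κ : ℕ} {α : Type} (R : Oracle κ) : QueryAlg κ α → α
  | ret a => a
  | ask q next => run R (next (R q))

/-- The number of queries in the execution in which the queries are answered by `R`
(repeated queries are counted each time). -/
def numQueries {κ : ℕ} {α : Type} (R : Oracle κ) : QueryAlg κ α → ℕ
  | ret _ => 0
  | ask q next => numQueries R (next (R q)) + 1

end QueryAlg

/-- A randomized query algorithm: the internal coins, tossed independently of the oracle, determine
a deterministic query algorithm. There is no bound on the running time. -/
abbrev RandAlg (κ : ℕ) (α : Type) : Type := PMF (QueryAlg κ α)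

namespace RandAlg

/-- The distribution, over the internal coins, of the output on the fixed oracle `R`. -/
def run {κ : ℕ} {α : Type} (A : RandAlg κ α) (R : Oracle κ) : PMF α :=
  PMF.map (QueryAlg.run R) A

/-- Every execution, for all coins and all oracles, makes at most `q` queries. -/
def QueriesAtMost {κ : ℕ} {α : Type} (A : RandAlg κ α) (q : ℕ) : Prop :=
  ∀ t ∈ A.support, ∀ R : Oracle κ, t.numQueries R ≤ q

end RandAlg

/-- The distribution of `m` independent samples of `p`. -/
def iidSamples {α : Type} [Fintype α] (p : PMF α) (m : ℕ) : PMF (Fin m → α) :=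
  PMF.ofFintype (fun x => ∏ i, p (x i)) (by
    classical
    have h := Finset.prod_univ_sum (fun _ : Fin m => (Finset.univ : Finset α))
      (fun _ a => p a)
    rw [Fintype.piFinset_univ] at h
    rw [← h]
    have h1 : ∑ a, p a = 1 := by rw [← tsum_fintype (L := .unconditional _)]; exact p.tsum_coe
    simp [h1])

/-- The probability `(1 - ρ) / 2` with which the `ρ`-noise channel flips a bit. -/
def flipProb (ρ : unitInterval) : NNReal := Real.toNNReal ((1 - (ρ : ℝ)) / 2)

theorem flipProb_le_one (ρ : unitInterval) : flipProb ρ ≤ 1 := by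
  have := ρ.2.1
  unfold flipProb
  rw [Real.toNNReal_le_one]
  linarith

/-- The error on one bit: `true` with probability `(1 - ρ) / 2`, and `false` otherwise. -/
def bitError (ρ : unitInterval) : PMF Bool :=
  PMF.ofFintype (fun b => if b then (flipProb ρ : ENNReal) else 1 - (flipProb ρ : ENNReal)) (by
    have h : (flipProb ρ : ENNReal) ≤ 1 := by exact_mod_cast flipProb_le_one ρ
    simp [add_tsub_cancel_of_le h])

/-- The `ρ`-noise channel (binary symmetric channel): `x` is mapped to `x ⊕ e`, where the bits of `e`
are independent and equal to `1` with probability `(1 - ρ) / 2`. -/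
def noise (ρ : unitInterval) {n : ℕ} (x : BitString n) : PMF (BitString n) :=
  PMF.map (fun e : BitString n => fun i => xor (x i) (e i))
    (iidSamples (bitError ρ) n)

/-- `f` is bounded by a polynomial. -/
def PolyBounded (f : ℕ → ℕ) : Prop :=
  ∃ p : Polynomial ℕ, ∀ κ, f κ ≤ p.eval κ

/-- `f` decays faster than every inverse polynomial. -/
def Negligible (f : ℕ → ℝ) : Prop :=
  SuperpolynomialDecay atTop (fun κ : ℕ => (κ : ℝ)) f

/-- The algorithms of a zero-bit code over the binary alphabet, for every value `κ` of the security
parameter. All of them have access to the same oracle `{0,1}^κ → {0,1}`. The decoder outputs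
`true` for the message `1` and `false` for `⊥`. -/
structure ZeroBitCode where
  keyLen : ℕ → ℕ
  blockLen : ℕ → ℕ
  keyGen : ∀ κ, RandAlg κ (BitString (keyLen κ))
  enc : ∀ κ, BitString (keyLen κ) → RandAlg κ (BitString (blockLen κ))
  dec : ∀ κ, BitString (keyLen κ) → BitString (blockLen κ) → RandAlg κ Bool

namespace ZeroBitCode

/-- The joint distribution of the random oracle and a secret key generated with it. -/
def setup (P : ZeroBitCode) (κ : ℕ) : PMF (Oracle κ × BitString (P.keyLen κ)) :=
  (PMF.uniformOfFintype (Oracle κ)).bind fun R =>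
    PMF.map (fun sk => (R, sk)) ((P.keyGen κ).run R)

/-- The output of the decoder on a codeword sent through the `ρ`-noise channel. -/
def completenessExp (P : ZeroBitCode) (κ : ℕ) (ρ : unitInterval) : PMF Bool :=
  (P.setup κ).bind fun s =>
    ((P.enc κ s.2).run s.1).bind fun c =>
      (noise ρ c).bind fun c' => (P.dec κ s.2 c').run s.1

/-- The output of the decoder on a fixed string. -/
def soundnessExp (P : ZeroBitCode) (κ : ℕ) (x : BitString (P.blockLen κ)) : PMF Bool :=
  (P.setup κ).bind fun s => (P.dec κ s.2 x).run s.1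

/-- The output of an adversary that receives `m` fresh encodings under one key and one oracle. The
adversary has no access to the oracle. -/
def realExp (P : ZeroBitCode) (κ m : ℕ)
    (A : (Fin m → BitString (P.blockLen κ)) → PMF Bool) : PMF Bool :=
  (P.setup κ).bind fun s => (iidSamples ((P.enc κ s.2).run s.1) m).bind A

/-- The output of an adversary that receives `m` independent uniformly random strings. -/
def idealExp (P : ZeroBitCode) (κ m : ℕ)
    (A : (Fin m → BitString (P.blockLen κ)) → PMF Bool) : PMF Bool :=
  (iidSamples (PMF.uniformOfFintype (BitString (P.blockLen κ))) m).bind A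

/-- `δ`-completeness, or robustness to the `ρ`-noise channel. -/
def IsComplete (P : ZeroBitCode) (ρ : ℕ → unitInterval) (δ : ℕ → ℝ) : Prop :=
  ∀ κ, 1 - δ κ ≤ (P.completenessExp κ (ρ κ) true).toReal

/-- `μ`-soundness. -/
def IsSound (P : ZeroBitCode) (μ : ℕ → ℝ) : Prop :=
  ∀ κ, ∀ x : BitString (P.blockLen κ), 1 - μ κ ≤ (P.soundnessExp κ x false).toReal

/-- Statistical `ε`-pseudorandomness: every computationally unbounded adversary that sees
polynomially many samples has advantage at most `ε` for all sufficiently large values of the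
security parameter (how large may depend on the adversary). -/
def IsPseudorandom (P : ZeroBitCode) (ε : ℕ → ℝ) : Prop :=
  ∀ m : ℕ → ℕ, PolyBounded m →
    ∀ A : ∀ κ, (Fin (m κ) → BitString (P.blockLen κ)) → PMF Bool,
      ∀ᶠ κ in atTop,
        |(P.realExp κ (m κ) (A κ) true).toReal - (P.idealExp κ (m κ) (A κ) true).toReal| ≤ ε κ

/-- A zero-bit `(δ, ε, μ)` pseudorandom code, robust to the `ρ`-noise channel, in the secret random
oracle model, with keys of polynomial length. -/
structure IsPRC (P : ZeroBitCode) (ρ : ℕ → unitInterval) (δ ε μ : ℕ → ℝ) : Prop where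
  polyKey : PolyBounded P.keyLen
  complete : P.IsComplete ρ δ
  pseudorandom : P.IsPseudorandom ε
  sound : P.IsSound μ

/-- One execution of each of the three algorithms makes at most `Q` oracle queries. -/
def QueriesAtMost (P : ZeroBitCode) (Q : ℕ → ℕ) : Prop :=
  ∀ κ, (P.keyGen κ).QueriesAtMost (Q κ) ∧
    ∀ sk : BitString (P.keyLen κ), (P.enc κ sk).QueriesAtMost (Q κ) ∧
      ∀ x : BitString (P.blockLen κ), (P.dec κ sk x).QueriesAtMost (Q κ)

end ZeroBitCode

end

/-!
Condition the oracle on a partial oracle that contains the queries of the key generation and the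
heaviest queries of the encoder, as many as a fixed power of the security parameter. Three facts
then bound the advantage of the decoder on a noisy codeword over its advantage on a uniform string.

* Given the key and the partial oracle, the law of a codeword is on average close to uniform. There
  are so few such pairs that polynomially many samples determine, for all pairs at once, the
  empirical average of the test that is optimal for the pair, and the largest of these averages
  would otherwise distinguish codewords from uniform strings.
* For a nearly uniform codeword, the encoder and the decoder rarely share a query outside the
  partial oracle. The encoder makes each such query with a small probability `M`, and two-function
  hypercontractivity for the noise channel turns this into the bound `Q * M ^ ((1 - ρ) / 4)`.
* Without shared queries, the oracles of the encoder and the decoder can be decoupled. The decoder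
  then sees a nearly uniform string, which it accepts with probability at most about `μ`.

Learning more queries gives `η ≥ k * (1 - ρ)` for every fixed `k` and large `λ`; a diagonal choice
of `k` gives `1 - ρ = o(η)`.
-/

noncomputable section

/-! ### Partial oracles -/

/-- A partial oracle on the queries in `X`; `none` stands for an unanswered query. Partial oracles
describe both the transcript of an execution and what has been learned about the oracle. -/
abbrev PartialOracle (X : Type*) : Type _ := X → Option Bool

/-- The law of one answer bit of a uniformly random oracle, given partial information on it. -/
def bitProb : Option Bool → Bool → ℝ
  | none, _ => 1 / 2
  | some b, b' => if b = b' then 1 else 0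

/-- The indicator of the consistency of an answer bit with partial information on it. -/
def bitMatch : Option Bool → Bool → ℝ
  | none, _ => 1
  | some b, b' => if b = b' then 1 else 0

theorem bitProb_nonneg (o : Option Bool) (b : Bool) : 0 ≤ bitProb o b := by
  rcases o with _ | (_ | _) <;> cases b <;> norm_num [bitProb]

theorem bitMatch_nonneg (o : Option Bool) (b : Bool) : 0 ≤ bitMatch o b := by
  rcases o with _ | (_ | _) <;> cases b <;> norm_num [bitMatch]

theorem sum_bitProb (o : Option Bool) : ∑ b, bitProb o b = 1 := by
  rcases o with _ | (_ | _) <;> simp [bitProb]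

theorem sum_pi_prod {ι β : Type*} [Fintype ι] [DecidableEq ι] [Fintype β] (f : ι → β → ℝ) :
    ∑ x : ι → β, ∏ i, f i (x i) = ∏ i, ∑ b, f i b := by
  rw [Finset.prod_univ_sum, Fintype.piFinset_univ]

section PartialOracle

variable {X : Type*} [Fintype X]

/-- The law of a uniformly random oracle conditioned on extending `K`. -/
def oracleProb (K : PartialOracle X) (R : X → Bool) : ℝ := ∏ q, bitProb (K q) (R q)

/-- The indicator of the event that `R` extends `S`. -/
def oracleMatch (S : PartialOracle X) (R : X → Bool) : ℝ := ∏ q, bitMatch (S q) (R q)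

/-- The number of queries answered by a partial oracle. -/
def PartialOracle.size (S : PartialOracle X) : ℕ := (Finset.univ.filter fun q => S q ≠ none).card

theorem oracleProb_nonneg (K : PartialOracle X) (R : X → Bool) : 0 ≤ oracleProb K R :=
  Finset.prod_nonneg fun _ _ => bitProb_nonneg _ _

theorem oracleMatch_nonneg (S : PartialOracle X) (R : X → Bool) : 0 ≤ oracleMatch S R :=
  Finset.prod_nonneg fun _ _ => bitMatch_nonneg _ _

theorem oracleMatch_eq_one {S : PartialOracle X} {R : X → Bool}
    (h : ∀ q b, S q = some b → R q = b) : oracleMatch S R = 1 := by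
  refine Finset.prod_eq_one fun q _ => ?_
  rcases hS : S q with _ | b
  · rfl
  · exact if_pos (h q b hS).symm

theorem oracleMatch_eq_zero {S : PartialOracle X} {R : X → Bool}
    (h : ¬ ∀ q b, S q = some b → R q = b) : oracleMatch S R = 0 := by
  push Not at h
  obtain ⟨q, b, hS, hR⟩ := h
  refine Finset.prod_eq_zero (Finset.mem_univ q) ?_
  rw [hS]
  exact if_neg hR.symm

theorem pow_size_eq_prod (x : ℝ) (S : PartialOracle X) :
    x ^ S.size = ∏ q, if S q ≠ none then x else 1 := by
  rw [PartialOracle.size, Finset.prod_ite, Finset.prod_const, Finset.prod_const_one, mul_one]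

theorem pow_card_mul_oracleMatch (S : PartialOracle X) (R : X → Bool) :
    (1 / 2) ^ Fintype.card X * oracleMatch S R = (1 / 2) ^ S.size * oracleProb S R := by
  rw [pow_size_eq_prod, oracleMatch, oracleProb, ← Finset.card_univ, ← Finset.prod_const,
    ← Finset.prod_mul_distrib, ← Finset.prod_mul_distrib]
  refine Finset.prod_congr rfl fun q _ => ?_
  rcases S q with _ | b <;> simp [bitProb, bitMatch]

variable [DecidableEq X]

theorem sum_oracleProb (K : PartialOracle X) : ∑ R, oracleProb K R = 1 :=
  (sum_pi_prod fun q => bitProb (K q)).trans (Finset.prod_eq_one fun q _ => sum_bitProb (K q))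

theorem size_update_le (K : PartialOracle X) (q : X) (b : Bool) :
    PartialOracle.size (Function.update K q (some b)) ≤ K.size + 1 := by
  refine (Finset.card_le_card (t := insert q (Finset.univ.filter fun x => K x ≠ none)) ?_).trans
    (Finset.card_insert_le _ _)
  intro x hx
  by_cases h : x = q
  · simp [h]
  · simpa [h, Function.update_of_ne h] using hx

theorem sum_pow_size (x : ℝ) :
    ∑ S : PartialOracle X, x ^ S.size = (1 + 2 * x) ^ Fintype.card X := by
  simp only [pow_size_eq_prod]
  rw [sum_pi_prod fun _ (o : Option Bool) => if o ≠ none then x else 1]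
  simp [Fintype.sum_option]

theorem card_size_le [Nonempty X] (D : ℕ) :
    ((Finset.univ.filter fun S : PartialOracle X => S.size ≤ D).card : ℝ) ≤
      (Fintype.card X : ℝ) ^ D * Real.exp 2 := by
  set N : ℝ := (Fintype.card X : ℝ) with hN
  have hN1 : 1 ≤ N := by rw [hN]; exact_mod_cast Fintype.card_pos
  have hN0 : 0 < N := by linarith
  have h_weight : ((Finset.univ.filter fun S : PartialOracle X => S.size ≤ D).card : ℝ) * N⁻¹ ^ D ≤
      ∑ S : PartialOracle X, N⁻¹ ^ S.size := by
    rw [← nsmul_eq_mul]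
    refine (Finset.card_nsmul_le_sum _ (fun S : PartialOracle X => N⁻¹ ^ S.size) _ fun S hS => ?_)
      |>.trans (Finset.sum_le_sum_of_subset_of_nonneg (Finset.filter_subset _ _)
        fun _ _ _ => by positivity)
    exact pow_le_pow_of_le_one (by positivity) (inv_le_one_of_one_le₀ hN1)
      (Finset.mem_filter.1 hS).2
  have h_exp : ∑ S : PartialOracle X, N⁻¹ ^ S.size ≤ Real.exp 2 := by
    calc ∑ S : PartialOracle X, N⁻¹ ^ S.size = (1 + 2 * N⁻¹) ^ Fintype.card X := sum_pow_size _
      _ ≤ Real.exp (2 * N⁻¹) ^ Fintype.card X := by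
          gcongr
          linarith [Real.add_one_le_exp (2 * N⁻¹)]
      _ = Real.exp 2 := by
          rw [← Real.exp_nat_mul, ← hN]
          congr 1
          field_simp
  rw [inv_pow, ← div_eq_mul_inv] at h_weight
  rw [mul_comm]
  exact (div_le_iff₀ (pow_pos hN0 D)).1 (h_weight.trans h_exp)

theorem oracleProb_eq_sum_update (K : PartialOracle X) {q : X} (hq : K q = none) (R : X → Bool) :
    oracleProb K R = ∑ b, 1 / 2 * oracleProb (Function.update K q (some b)) R := by
  have h_update : ∀ b, oracleProb (Function.update K q (some b)) R =
      bitProb (some b) (R q) * ∏ x ∈ Finset.univ.erase q, bitProb (K x) (R x) := by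
    intro b
    rw [oracleProb, ← Finset.mul_prod_erase _ _ (Finset.mem_univ q), Function.update_self]
    congr 1
    refine Finset.prod_congr rfl fun x hx => ?_
    rw [Function.update_of_ne (Finset.ne_of_mem_erase hx)]
  simp only [h_update]
  rw [oracleProb, ← Finset.mul_prod_erase _ _ (Finset.mem_univ q), hq]
  cases R q <;> simp [bitProb]

/-- The probability that a uniformly random oracle extending `K` extends `S`. -/
def matchProb (K S : PartialOracle X) : ℝ := ∑ R, oracleProb K R * oracleMatch S R

/-- The probability that a uniformly random oracle extending `K` extends both `S` and `T`. -/
def jointMatchProb (K S T : PartialOracle X) : ℝ :=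
  ∑ R, oracleProb K R * (oracleMatch S R * oracleMatch T R)

/-- `S` and `T` answer a common query that `K` does not answer. -/
def Collide (K S T : PartialOracle X) : Prop := ∃ q, K q = none ∧ S q ≠ none ∧ T q ≠ none

theorem matchProb_nonneg (K S : PartialOracle X) : 0 ≤ matchProb K S :=
  Finset.sum_nonneg fun _ _ => mul_nonneg (oracleProb_nonneg _ _) (oracleMatch_nonneg _ _)

theorem jointMatchProb_nonneg (K S T : PartialOracle X) : 0 ≤ jointMatchProb K S T :=
  Finset.sum_nonneg fun _ _ => mul_nonneg (oracleProb_nonneg _ _)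
    (mul_nonneg (oracleMatch_nonneg _ _) (oracleMatch_nonneg _ _))

theorem matchProb_eq_prod (K S : PartialOracle X) :
    matchProb K S = ∏ q, ∑ b, bitProb (K q) b * bitMatch (S q) b := by
  rw [← sum_pi_prod fun q b => bitProb (K q) b * bitMatch (S q) b]
  simp only [matchProb, oracleProb, oracleMatch, Finset.prod_mul_distrib]

theorem jointMatchProb_eq_prod (K S T : PartialOracle X) :
    jointMatchProb K S T =
      ∏ q, ∑ b, bitProb (K q) b * (bitMatch (S q) b * bitMatch (T q) b) := by
  rw [← sum_pi_prod fun q b => bitProb (K q) b * (bitMatch (S q) b * bitMatch (T q) b)]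
  simp only [jointMatchProb, oracleProb, oracleMatch, Finset.prod_mul_distrib]

theorem matchProb_eq_sum_update (K S : PartialOracle X) {q : X} (hq : K q = none) :
    matchProb K S = ∑ b, 1 / 2 * matchProb (Function.update K q (some b)) S := by
  simp only [matchProb, oracleProb_eq_sum_update K hq, Finset.sum_mul, Finset.mul_sum]
  rw [Finset.sum_comm]
  simp only [mul_assoc]

theorem jointMatchProb_of_not_collide {K S T : PartialOracle X} (h : ¬ Collide K S T) :
    jointMatchProb K S T = matchProb K S * matchProb K T := by
  rw [jointMatchProb_eq_prod, matchProb_eq_prod, matchProb_eq_prod, ← Finset.prod_mul_distrib]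
  refine Finset.prod_congr rfl fun q _ => ?_
  have hq : ¬ (K q = none ∧ S q ≠ none ∧ T q ≠ none) := fun hq => h ⟨q, hq⟩
  generalize K q = k, S q = s, T q = t at hq
  rcases k with _ | (_ | _) <;> rcases s with _ | (_ | _) <;> rcases t with _ | (_ | _) <;>
    simp_all [bitProb, bitMatch]

theorem jointMatchProb_le (K S T : PartialOracle X) :
    jointMatchProb K S T ≤ 2 ^ S.size * (matchProb K S * matchProb K T) := by
  rw [jointMatchProb_eq_prod, matchProb_eq_prod, matchProb_eq_prod, ← Finset.prod_mul_distrib,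
    pow_size_eq_prod, ← Finset.prod_mul_distrib]
  refine Finset.prod_le_prod (fun q _ => Finset.sum_nonneg fun b _ =>
    mul_nonneg (bitProb_nonneg _ _) (mul_nonneg (bitMatch_nonneg _ _) (bitMatch_nonneg _ _)))
    fun q _ => ?_
  generalize K q = k, S q = s, T q = t
  rcases k with _ | (_ | _) <;> rcases s with _ | (_ | _) <;> rcases t with _ | (_ | _) <;>
    simp [bitProb, bitMatch] <;> norm_num

end PartialOracle

/-! ### Leaves of query algorithms -/

namespace QueryAlg

variable {κ : ℕ} {α : Type}

/-- The queries and answers of the execution in which the queries are answered by `R`. -/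
def trace (R : Oracle κ) : QueryAlg κ α → PartialOracle (BitString κ)
  | ret _ => fun _ => none
  | ask q next => Function.update (trace R (next (R q))) q (some (R q))

theorem eq_of_trace_eq_some (R : Oracle κ) (t : QueryAlg κ α) (q : BitString κ) (b : Bool)
    (h : t.trace R q = some b) : R q = b := by
  induction t with
  | ret a => simp [trace] at h
  | ask p next ih =>
    by_cases hp : q = p
    · subst hp
      simpa [trace] using h
    · rw [trace, Function.update_of_ne hp] at h
      exact ih _ h

theorem run_and_trace_congr (R R' : Oracle κ) (t : QueryAlg κ α)
    (h : ∀ q b, t.trace R q = some b → R' q = b) :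
    t.run R' = t.run R ∧ t.trace R' = t.trace R := by
  induction t with
  | ret a => exact ⟨rfl, rfl⟩
  | ask p next ih =>
    have hp : R' p = R p := h p _ (Function.update_self ..)
    have h_next := ih (R p) fun q b hq => by
      by_cases hqp : q = p
      · subst hqp
        rw [hp, eq_of_trace_eq_some R _ _ _ hq]
      · exact h q b (by rw [trace, Function.update_of_ne hqp, hq])
    simp only [run, trace, hp]
    exact ⟨h_next.1, by rw [h_next.2]⟩

theorem size_trace_le (R : Oracle κ) (t : QueryAlg κ α) : (t.trace R).size ≤ t.numQueries R := by
  induction t with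
  | ret a => simp [trace, PartialOracle.size]
  | ask p next ih => exact (size_update_le _ _ _).trans (Nat.succ_le_succ (ih _))

/-- The output `a` and the trace `S` belong to a leaf of the decision tree `t`: some oracle leads
to both. -/
def IsLeaf (t : QueryAlg κ α) (a : α) (S : PartialOracle (BitString κ)) : Prop :=
  ∃ R, t.run R = a ∧ t.trace R = S

theorem isLeaf_and_extends_iff (R : Oracle κ) (t : QueryAlg κ α) (a : α)
    (S : PartialOracle (BitString κ)) :
    (t.IsLeaf a S ∧ ∀ q b, S q = some b → R q = b) ↔ t.run R = a ∧ t.trace R = S := by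
  constructor
  · rintro ⟨⟨R', rfl, rfl⟩, h⟩
    exact run_and_trace_congr R' R t h
  · rintro ⟨rfl, rfl⟩
    exact ⟨⟨R, rfl, rfl⟩, eq_of_trace_eq_some R t⟩

end QueryAlg

/-- The leaf weights of a randomized algorithm with at most `Q` queries: the execution with the
oracle `R` has output `a` and trace `S` with probability `W a S` if `R` extends `S`, and with
probability `0` otherwise. -/
structure IsLeafWeight {X α : Type*} [Fintype X] [DecidableEq X] [Fintype α]
    (W : α → PartialOracle X → ℝ) (Q : ℕ) : Prop where
  nonneg : ∀ a S, 0 ≤ W a S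
  sum_eq_one : ∀ R : X → Bool, ∑ a, ∑ S, W a S * oracleMatch S R = 1
  size_le : ∀ a S, W a S ≠ 0 → S.size ≤ Q

theorem sum_toReal_pmf {α : Type*} [Fintype α] (p : PMF α) : ∑ a, (p a).toReal = 1 := by
  rw [← ENNReal.toReal_sum fun a _ => p.apply_ne_top a, ← tsum_fintype (L := .unconditional _),
    p.tsum_coe, ENNReal.toReal_one]

theorem toReal_pmf_bind_apply {α β : Type*} [Fintype α] (p : PMF α) (f : α → PMF β) (b : β) :
    (p.bind f b).toReal = ∑ a, (p a).toReal * (f a b).toReal := by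
  rw [PMF.bind_apply, tsum_fintype, ENNReal.toReal_sum]
  · simp only [ENNReal.toReal_mul]
  · exact fun a _ => ENNReal.mul_ne_top (p.apply_ne_top a) ((f a).apply_ne_top b)

theorem toReal_iidSamples {α : Type} [Fintype α] (p : PMF α) (m : ℕ) (x : Fin m → α) :
    (iidSamples p m x).toReal = ∏ i, (p (x i)).toReal := by
  simp [iidSamples, ENNReal.toReal_prod]

namespace RandAlg

variable {κ : ℕ} {α : Type} (A : RandAlg κ α)

/-- The probability, over the coins of `A`, that `A` has a leaf with output `a` and trace `S`. -/
def leafWeight (a : α) (S : PartialOracle (BitString κ)) : ℝ :=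
  (A.toOuterMeasure {t | t.IsLeaf a S}).toReal

theorem run_apply_eq_sum (R : Oracle κ) (a : α) :
    A.run R a = ∑ S, A.toOuterMeasure {t | t.run R = a ∧ t.trace R = S} := by
  classical
  simp only [run, PMF.map_apply, PMF.toOuterMeasure_apply]
  rw [← Summable.tsum_finsetSum fun _ _ => ENNReal.summable]
  refine tsum_congr fun t => ?_
  simp [Set.indicator_apply, ite_and, eq_comm (a := a)]

theorem toOuterMeasure_ne_top (s : Set (QueryAlg κ α)) : A.toOuterMeasure s ≠ ⊤ := by
  rw [PMF.toOuterMeasure_apply]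
  exact ne_top_of_le_ne_top A.tsum_coe_ne_top
    (ENNReal.tsum_le_tsum fun t => Set.indicator_le_self _ _ t)

theorem toReal_run_eq_sum (R : Oracle κ) (a : α) :
    (A.run R a).toReal = ∑ S, A.leafWeight a S * oracleMatch S R := by
  rw [run_apply_eq_sum, ENNReal.toReal_sum fun S _ => A.toOuterMeasure_ne_top _]
  refine Finset.sum_congr rfl fun S _ => ?_
  simp only [← QueryAlg.isLeaf_and_extends_iff, leafWeight]
  by_cases h : ∀ q b, S q = some b → R q = b
  · simp only [eq_true h, and_true, oracleMatch_eq_one h, mul_one]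
  · simp only [eq_false h, and_false, Set.ofPred_false, MeasureTheory.measure_empty,
      ENNReal.toReal_zero, oracleMatch_eq_zero h, mul_zero]

theorem isLeafWeight_leafWeight [Fintype α] {Q : ℕ} (hA : A.QueriesAtMost Q) :
    IsLeafWeight A.leafWeight Q where
  nonneg a S := ENNReal.toReal_nonneg
  sum_eq_one R := by simp only [← toReal_run_eq_sum, sum_toReal_pmf]
  size_le a S h := by
    have h_support : ¬ Disjoint A.support {t | t.IsLeaf a S} := fun h_disjoint =>
      h (by rw [leafWeight, (PMF.toOuterMeasure_apply_eq_zero_iff _ _).2 h_disjoint,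
        ENNReal.toReal_zero])
    obtain ⟨t, ht, R, -, rfl⟩ := Set.not_disjoint_iff.1 h_support
    exact (t.size_trace_le R).trans (hA t ht R)

end RandAlg

/-! ### The noise channel and two-function hypercontractivity -/

/-- The probability that the `ρ`-noise channel maps `x` to `y`. -/
def noiseKernel (ρ : ℝ) {n : ℕ} (x y : BitString n) : ℝ :=
  ∏ i, if x i = y i then (1 + ρ) / 2 else (1 - ρ) / 2

theorem toReal_bitError (ρ : unitInterval) (b : Bool) :
    (bitError ρ b).toReal = if b then (1 - (ρ : ℝ)) / 2 else (1 + ρ) / 2 := by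
  have h_coe : (flipProb ρ : ℝ) = (1 - ρ) / 2 := Real.coe_toNNReal _ (by linarith [ρ.2.2])
  cases b
  · have h_le : (flipProb ρ : ENNReal) ≤ 1 := by exact_mod_cast flipProb_le_one ρ
    simp only [bitError, PMF.ofFintype_apply, Bool.false_eq_true, if_false]
    rw [ENNReal.toReal_sub_of_le h_le ENNReal.one_ne_top, ENNReal.coe_toReal, h_coe,
      ENNReal.toReal_one]
    ring
  · simpa [bitError] using h_coe

theorem toReal_noise (ρ : unitInterval) {n : ℕ} (x y : BitString n) :
    (noise ρ x y).toReal = noiseKernel ρ x y := by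
  classical
  rw [noise, PMF.map_apply, tsum_eq_single fun i => xor (x i) (y i)]
  · rw [if_pos (by ext i; simp), toReal_iidSamples]
    refine Finset.prod_congr rfl fun i _ => ?_
    rw [toReal_bitError]
    cases x i <;> cases y i <;> rfl
  · intro e he
    refine if_neg ?_
    rintro rfl
    exact he (by ext i; simp)

theorem noiseKernel_nonneg {ρ : ℝ} (h0 : 0 ≤ ρ) (h1 : ρ ≤ 1) {n : ℕ} (x y : BitString n) :
    0 ≤ noiseKernel ρ x y := by
  refine Finset.prod_nonneg fun i _ => ?_
  split_ifs <;> linarith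

theorem noiseKernel_comm (ρ : ℝ) {n : ℕ} (x y : BitString n) :
    noiseKernel ρ x y = noiseKernel ρ y x := by
  simp only [noiseKernel, eq_comm]

theorem sum_noiseKernel (ρ : ℝ) {n : ℕ} (x : BitString n) : ∑ y, noiseKernel ρ x y = 1 := by
  refine (sum_pi_prod fun i b => if x i = b then (1 + ρ) / 2 else (1 - ρ) / 2).trans
    (Finset.prod_eq_one fun i _ => ?_)
  rw [Fintype.sum_bool]
  cases x i <;> norm_num <;> ring

theorem noiseKernel_cons (ρ : ℝ) {n : ℕ} (b b' : Bool) (x y : BitString n) :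
    noiseKernel ρ (Fin.cons b x : BitString (n + 1)) (Fin.cons b' y) =
      (if b = b' then (1 + ρ) / 2 else (1 - ρ) / 2) * noiseKernel ρ x y := by
  simp [noiseKernel, Fin.prod_univ_succ]

theorem sum_bitString_succ {n : ℕ} (F : BitString (n + 1) → ℝ) :
    ∑ x, F x = ∑ b : Bool, ∑ x : BitString n, F (Fin.cons b x) := by
  rw [← (Fin.consEquiv fun _ : Fin (n + 1) => Bool).sum_comp, Fintype.sum_prod_type]
  rfl

section TwoPoint

variable {ρ : ℝ}

theorem two_mul_le_one_add_rpow_sub_one_sub_rpow (h0 : 0 ≤ ρ) (h1 : ρ ≤ 1) {t : ℝ} (ht0 : 0 ≤ t)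
    (ht1 : t ≤ 1) : 2 * ρ * t ≤ (1 + t) ^ ρ - (1 - t) ^ ρ := by
  let h : ℝ → ℝ := fun t => (1 + t) ^ ρ - (1 - t) ^ ρ - 2 * ρ * t
  have h_cont : ContinuousOn h (Set.Icc 0 1) := by
    refine Continuous.continuousOn ?_
    fun_prop (disch := exact fun _ => Or.inr h0)
  have h_deriv : ∀ x ∈ interior (Set.Icc (0 : ℝ) 1), HasDerivWithinAt h
      (ρ * ((1 + x) ^ (ρ - 1) + (1 - x) ^ (ρ - 1) - 2)) (interior (Set.Icc 0 1)) x := by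
    intro x hx
    rw [interior_Icc] at hx
    have h_add := ((hasDerivAt_id' x).const_add 1).rpow_const (p := ρ)
      (Or.inl (by linarith [hx.1]))
    have h_sub := ((hasDerivAt_id' x).const_sub 1).rpow_const (p := ρ)
      (Or.inl (by linarith [hx.2]))
    exact (((h_add.sub h_sub).sub ((hasDerivAt_id' x).const_mul (2 * ρ))).congr_deriv
      (by ring)).hasDerivWithinAt
  -- AM-GM: the two powers have product at least one, because `(1 + x) * (1 - x) ≤ 1`.
  have h_deriv_nonneg : ∀ x ∈ interior (Set.Icc (0 : ℝ) 1),
      0 ≤ ρ * ((1 + x) ^ (ρ - 1) + (1 - x) ^ (ρ - 1) - 2) := by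
    intro x hx
    rw [interior_Icc] at hx
    have hA : 0 < 1 + x := by linarith [hx.1]
    have hB : 0 < 1 - x := by linarith [hx.2]
    have h_prod : 1 ≤ (1 + x) ^ (ρ - 1) * (1 - x) ^ (ρ - 1) := by
      rw [← Real.mul_rpow hA.le hB.le]
      exact Real.one_le_rpow_of_pos_of_le_one_of_nonpos (by positivity)
        (by nlinarith [sq_nonneg x]) (by linarith)
    refine mul_nonneg h0 ?_
    nlinarith [sq_nonneg ((1 + x) ^ (ρ - 1) - (1 - x) ^ (ρ - 1)),
      Real.rpow_pos_of_pos hA (ρ - 1), Real.rpow_pos_of_pos hB (ρ - 1)]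
  have h_mono := monotoneOn_of_hasDerivWithinAt_nonneg (convex_Icc 0 1) h_cont h_deriv
    h_deriv_nonneg ⟨le_rfl, zero_le_one⟩ ⟨ht0, ht1⟩ ht0
  simp only [h, add_zero, sub_zero, mul_zero, sub_self] at h_mono
  linarith

theorem one_add_sq_le_rpow_mean (h0 : 0 ≤ ρ) (h1 : ρ ≤ 1) {t : ℝ} (ht0 : 0 ≤ t) (ht1 : t ≤ 1) :
    1 + (1 + ρ) * ρ / 2 * t ^ 2 ≤ ((1 + t) ^ (1 + ρ) + (1 - t) ^ (1 + ρ)) / 2 := by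
  let h : ℝ → ℝ := fun t => ((1 + t) ^ (1 + ρ) + (1 - t) ^ (1 + ρ)) / 2 - (1 + ρ) * ρ / 2 * t ^ 2
  have h_cont : ContinuousOn h (Set.Icc 0 1) := by
    refine Continuous.continuousOn ?_
    fun_prop (disch := grind)
  have h_deriv : ∀ x ∈ interior (Set.Icc (0 : ℝ) 1), HasDerivWithinAt h
      ((1 + ρ) / 2 * ((1 + x) ^ ρ - (1 - x) ^ ρ - 2 * ρ * x)) (interior (Set.Icc 0 1)) x := by
    intro x hx
    rw [interior_Icc] at hx
    have h_add := ((hasDerivAt_id' x).const_add 1).rpow_const (p := 1 + ρ)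
      (Or.inl (by linarith [hx.1]))
    have h_sub := ((hasDerivAt_id' x).const_sub 1).rpow_const (p := 1 + ρ)
      (Or.inl (by linarith [hx.2]))
    refine ((((h_add.add h_sub).div_const 2).sub
      (((hasDerivAt_id' x).pow 2).const_mul ((1 + ρ) * ρ / 2))).congr_deriv
      ?_).hasDerivWithinAt
    rw [add_sub_cancel_left]
    push_cast
    ring
  have h_deriv_nonneg : ∀ x ∈ interior (Set.Icc (0 : ℝ) 1),
      0 ≤ (1 + ρ) / 2 * ((1 + x) ^ ρ - (1 - x) ^ ρ - 2 * ρ * x) := by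
    intro x hx
    rw [interior_Icc] at hx
    have := two_mul_le_one_add_rpow_sub_one_sub_rpow h0 h1 hx.1.le hx.2.le
    exact mul_nonneg (by linarith) (by linarith)
  have h_mono := monotoneOn_of_hasDerivWithinAt_nonneg (convex_Icc 0 1) h_cont h_deriv
    h_deriv_nonneg ⟨le_rfl, zero_le_one⟩ ⟨ht0, ht1⟩ ht0
  norm_num [h] at h_mono
  linarith

theorem sqrt_one_add_mul_sq_le_rpow_mean (h0 : 0 ≤ ρ) (h1 : ρ ≤ 1) {t : ℝ} (ht0 : 0 ≤ t)
    (ht1 : t ≤ 1) :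
    √(1 + ρ * t ^ 2) ≤ (((1 + t) ^ (1 + ρ) + (1 - t) ^ (1 + ρ)) / 2) ^ (1 / (1 + ρ)) := by
  have h_bernoulli : (1 + ρ * t ^ 2) ^ ((1 + ρ) / 2) ≤ 1 + (1 + ρ) / 2 * (ρ * t ^ 2) :=
    rpow_one_add_le_one_add_mul_self (by nlinarith [sq_nonneg t]) (by linarith) (by linarith)
  calc √(1 + ρ * t ^ 2) = ((1 + ρ * t ^ 2) ^ ((1 + ρ) / 2)) ^ (1 / (1 + ρ)) := by
        rw [Real.sqrt_eq_rpow, ← Real.rpow_mul (by positivity)]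
        congr 1
        field_simp
    _ ≤ _ := by
        gcongr
        linarith [one_add_sq_le_rpow_mean h0 h1 ht0 ht1]

theorem sqrt_le_rpow_mean_of_le (h0 : 0 ≤ ρ) (h1 : ρ ≤ 1) {a b : ℝ} (hb : 0 ≤ b) (hab : b ≤ a) :
    √(((a + b) / 2) ^ 2 + ρ * ((a - b) / 2) ^ 2) ≤
      ((a ^ (1 + ρ) + b ^ (1 + ρ)) / 2) ^ (1 / (1 + ρ)) := by
  rcases (hb.trans hab).eq_or_lt with rfl | ha
  · obtain rfl : b = 0 := le_antisymm hab hb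
    norm_num
    positivity
  obtain ⟨m, t, hm, ht0, ht1, rfl, rfl⟩ : ∃ m t : ℝ, 0 < m ∧ 0 ≤ t ∧ t ≤ 1 ∧
      m * (1 + t) = a ∧ m * (1 - t) = b := by
    refine ⟨(a + b) / 2, (a - b) / (a + b), by positivity, div_nonneg (by linarith) (by linarith),
      (div_le_one (by linarith)).2 (by linarith), ?_, ?_⟩ <;> field_simp <;> ring
  have h_sqrt : √(((m * (1 + t) + m * (1 - t)) / 2) ^ 2 +
      ρ * ((m * (1 + t) - m * (1 - t)) / 2) ^ 2) = m * √(1 + ρ * t ^ 2) := by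
    rw [← Real.sqrt_sq hm.le, ← Real.sqrt_mul (sq_nonneg _), Real.sqrt_sq hm.le]
    congr 1
    ring
  have h_mean : (((m * (1 + t)) ^ (1 + ρ) + (m * (1 - t)) ^ (1 + ρ)) / 2) ^ (1 / (1 + ρ)) =
      m * (((1 + t) ^ (1 + ρ) + (1 - t) ^ (1 + ρ)) / 2) ^ (1 / (1 + ρ)) := by
    have h_add := Real.rpow_nonneg (show 0 ≤ 1 + t by linarith) (1 + ρ)
    have h_sub := Real.rpow_nonneg (show 0 ≤ 1 - t by linarith) (1 + ρ)
    rw [Real.mul_rpow hm.le (by linarith), Real.mul_rpow hm.le (by linarith), ← mul_add,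
      mul_div_assoc,
      Real.mul_rpow (by positivity) (div_nonneg (add_nonneg h_add h_sub) zero_le_two),
      ← Real.rpow_mul hm.le, mul_one_div_cancel (by linarith), Real.rpow_one]
  rw [h_sqrt, h_mean]
  exact mul_le_mul_of_nonneg_left (sqrt_one_add_mul_sq_le_rpow_mean h0 h1 ht0 ht1) hm.le

theorem sqrt_le_rpow_mean (h0 : 0 ≤ ρ) (h1 : ρ ≤ 1) {a b : ℝ} (ha : 0 ≤ a) (hb : 0 ≤ b) :
    √(((a + b) / 2) ^ 2 + ρ * ((a - b) / 2) ^ 2) ≤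
      ((a ^ (1 + ρ) + b ^ (1 + ρ)) / 2) ^ (1 / (1 + ρ)) := by
  rcases le_total b a with h | h
  · exact sqrt_le_rpow_mean_of_le h0 h1 hb h
  · rw [add_comm a b, add_comm (a ^ _), ← neg_sub b a, neg_div, neg_sq]
    exact sqrt_le_rpow_mean_of_le h0 h1 ha h

theorem two_point_hypercontractive (h0 : 0 ≤ ρ) (h1 : ρ ≤ 1) {a b c d : ℝ} (ha : 0 ≤ a)
    (hb : 0 ≤ b) (hc : 0 ≤ c) (hd : 0 ≤ d) :
    (1 + ρ) / 4 * (a * c + b * d) + (1 - ρ) / 4 * (a * d + b * c) ≤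
      ((a ^ (1 + ρ) + b ^ (1 + ρ)) / 2) ^ (1 / (1 + ρ)) *
        ((c ^ (1 + ρ) + d ^ (1 + ρ)) / 2) ^ (1 / (1 + ρ)) := by
  refine le_trans ?_ (mul_le_mul (sqrt_le_rpow_mean h0 h1 ha hb) (sqrt_le_rpow_mean h0 h1 hc hd)
    (Real.sqrt_nonneg _) (by positivity))
  rw [← Real.sqrt_mul (by positivity)]
  apply Real.le_sqrt_of_sq_le
  -- The left-hand side is `u * v + ρ * u' * v'` for half sums `u, v` and half differences `u', v'`.
  nlinarith [mul_nonneg h0 (sq_nonneg ((a + b) / 2 * ((c - d) / 2) - (a - b) / 2 * ((c + d) / 2)))]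

end TwoPoint

/-- The `L^p` norm of a nonnegative function for the uniform probability measure on the cube. -/
def cubeNorm (p : ℝ) {n : ℕ} (f : BitString n → ℝ) : ℝ := ((1 / 2) ^ n * ∑ x, f x ^ p) ^ (1 / p)

/-- The bilinear form `⟨f, T_ρ g⟩` of the noise operator for the uniform probability measure. -/
def noiseForm (ρ : ℝ) {n : ℕ} (f g : BitString n → ℝ) : ℝ :=
  (1 / 2) ^ n * ∑ x, ∑ y, noiseKernel ρ x y * (f x * g y)

theorem noiseForm_succ (ρ : ℝ) {n : ℕ} (f g : BitString (n + 1) → ℝ) :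
    noiseForm ρ f g = ∑ b : Bool, ∑ b' : Bool, (if b = b' then (1 + ρ) / 4 else (1 - ρ) / 4) *
      noiseForm ρ (fun x : BitString n => f (Fin.cons b x)) fun x => g (Fin.cons b' x) := by
  simp only [noiseForm, sum_bitString_succ, noiseKernel_cons, Finset.mul_sum]
  refine Finset.sum_congr rfl fun b _ => ?_
  rw [Finset.sum_comm]
  refine Finset.sum_congr rfl fun b' _ => Finset.sum_congr rfl fun x _ =>
    Finset.sum_congr rfl fun y _ => ?_
  split_ifs <;> ring

section CubeNorm

variable {p : ℝ} {n : ℕ}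

theorem sum_rpow_nonneg {f : BitString n → ℝ} (hf : ∀ x, 0 ≤ f x) :
    0 ≤ (1 / 2 : ℝ) ^ n * ∑ x, f x ^ p :=
  mul_nonneg (by positivity) (Finset.sum_nonneg fun x _ => Real.rpow_nonneg (hf x) p)

theorem cubeNorm_nonneg {f : BitString n → ℝ} (hf : ∀ x, 0 ≤ f x) : 0 ≤ cubeNorm p f :=
  Real.rpow_nonneg (sum_rpow_nonneg hf) _

theorem cubeNorm_rpow (hp : 0 < p) {f : BitString n → ℝ} (hf : ∀ x, 0 ≤ f x) :
    cubeNorm p f ^ p = (1 / 2) ^ n * ∑ x, f x ^ p := by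
  rw [cubeNorm, ← Real.rpow_mul (sum_rpow_nonneg hf), one_div_mul_cancel hp.ne', Real.rpow_one]

theorem cubeNorm_zero (hp : 0 < p) {f : BitString 0 → ℝ} (hf : ∀ x, 0 ≤ f x) (x : BitString 0) :
    cubeNorm p f = f x := by
  rw [cubeNorm, Fintype.sum_subsingleton _ x, pow_zero, one_mul, ← Real.rpow_mul (hf _),
    mul_one_div_cancel hp.ne', Real.rpow_one]

theorem cubeNorm_succ (hp : 0 < p) {f : BitString (n + 1) → ℝ} (hf : ∀ x, 0 ≤ f x) :
    cubeNorm p f = ((cubeNorm p (fun x : BitString n => f (Fin.cons true x)) ^ p +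
      cubeNorm p (fun x : BitString n => f (Fin.cons false x)) ^ p) / 2) ^ (1 / p) := by
  rw [cubeNorm_rpow hp fun x => hf _, cubeNorm_rpow hp fun x => hf _, cubeNorm,
    sum_bitString_succ, Fintype.sum_bool]
  congr 1
  ring

end CubeNorm

theorem noiseForm_le_cubeNorm_mul_cubeNorm {ρ : ℝ} (h0 : 0 ≤ ρ) (h1 : ρ ≤ 1) {n : ℕ}
    {f g : BitString n → ℝ} (hf : ∀ x, 0 ≤ f x) (hg : ∀ x, 0 ≤ g x) :
    noiseForm ρ f g ≤ cubeNorm (1 + ρ) f * cubeNorm (1 + ρ) g := by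
  have hp : 0 < 1 + ρ := by linarith
  induction n with
  | zero =>
    rw [cubeNorm_zero hp hf default, cubeNorm_zero hp hg default, noiseForm,
      Fintype.sum_subsingleton _ default, Fintype.sum_subsingleton _ default]
    simp [noiseKernel]
  | succ n ih =>
    have h_face (b b' : Bool) : noiseForm ρ (fun x : BitString n => f (Fin.cons b x))
        (fun x => g (Fin.cons b' x)) ≤ cubeNorm (1 + ρ) (fun x : BitString n => f (Fin.cons b x)) *
          cubeNorm (1 + ρ) fun x : BitString n => g (Fin.cons b' x) :=
      ih (fun x => hf _) fun x => hg _
    have h_two_point := two_point_hypercontractive h0 h1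
      (cubeNorm_nonneg (p := 1 + ρ) fun x : BitString n => hf (Fin.cons true x))
      (cubeNorm_nonneg (p := 1 + ρ) fun x : BitString n => hf (Fin.cons false x))
      (cubeNorm_nonneg (p := 1 + ρ) fun x : BitString n => hg (Fin.cons true x))
      (cubeNorm_nonneg (p := 1 + ρ) fun x : BitString n => hg (Fin.cons false x))
    rw [← cubeNorm_succ hp hf, ← cubeNorm_succ hp hg] at h_two_point
    refine le_trans ?_ h_two_point
    rw [noiseForm_succ, mul_add, mul_add]
    simp only [Fintype.sum_bool, if_true, Bool.true_eq_false, Bool.false_eq_true, if_false]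
    have h_same : 0 ≤ (1 + ρ) / 4 := by linarith
    have h_diff : 0 ≤ (1 - ρ) / 4 := by linarith
    linarith [mul_le_mul_of_nonneg_left (h_face true true) h_same,
      mul_le_mul_of_nonneg_left (h_face false false) h_same,
      mul_le_mul_of_nonneg_left (h_face true false) h_diff,
      mul_le_mul_of_nonneg_left (h_face false true) h_diff]

/-! ### Collisions between the queries of encoder and decoder -/

section OutputLaw

variable {X α : Type*} [Fintype X] [DecidableEq X]

/-- The output law, on a uniformly random oracle extending `K`, of an algorithm with leaf
weights `W`. -/
def outProb (W : α → PartialOracle X → ℝ) (K : PartialOracle X) (a : α) : ℝ :=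
  ∑ S, W a S * matchProb K S

/-- The probability that an algorithm with leaf weights `W` outputs `a` and asks `q`, on a uniformly
random oracle extending `K`. -/
def outQueryProb (W : α → PartialOracle X → ℝ) (K : PartialOracle X) (q : X) (a : α) : ℝ :=
  ∑ S, W a S * (matchProb K S * if S q ≠ none then 1 else 0)

theorem outProb_nonneg {W : α → PartialOracle X → ℝ} (hW : ∀ a S, 0 ≤ W a S)
    (K : PartialOracle X) (a : α) : 0 ≤ outProb W K a :=
  Finset.sum_nonneg fun S _ => mul_nonneg (hW a S) (matchProb_nonneg K S)

theorem outQueryProb_nonneg {W : α → PartialOracle X → ℝ} (hW : ∀ a S, 0 ≤ W a S)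
    (K : PartialOracle X) (q : X) (a : α) : 0 ≤ outQueryProb W K q a :=
  Finset.sum_nonneg fun S _ => mul_nonneg (hW a S)
    (mul_nonneg (matchProb_nonneg K S) (by split_ifs <;> norm_num))

theorem outQueryProb_le_outProb {W : α → PartialOracle X → ℝ} (hW : ∀ a S, 0 ≤ W a S)
    (K : PartialOracle X) (q : X) (a : α) : outQueryProb W K q a ≤ outProb W K a :=
  Finset.sum_le_sum fun S _ => mul_le_mul_of_nonneg_left
    (mul_le_of_le_one_right (matchProb_nonneg K S) (by split_ifs <;> norm_num)) (hW a S)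

theorem outProb_mul (r : α → ℝ) (W : α → PartialOracle X → ℝ) (K : PartialOracle X) (a : α) :
    outProb (fun a S => r a * W a S) K a = r a * outProb W K a := by
  simp only [outProb, mul_assoc, Finset.mul_sum]

theorem outQueryProb_mul (r : α → ℝ) (W : α → PartialOracle X → ℝ) (K : PartialOracle X) (q : X)
    (a : α) : outQueryProb (fun a S => r a * W a S) K q a = r a * outQueryProb W K q a := by
  simp only [outQueryProb, mul_assoc, Finset.mul_sum]

variable [Fintype α]

/-- The probability that an algorithm with leaf weights `W` asks `q`, on a uniformly random oracle
extending `K`. -/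
def queryProb (W : α → PartialOracle X → ℝ) (K : PartialOracle X) (q : X) : ℝ :=
  ∑ a, outQueryProb W K q a

theorem queryProb_nonneg {W : α → PartialOracle X → ℝ} (hW : ∀ a S, 0 ≤ W a S)
    (K : PartialOracle X) (q : X) : 0 ≤ queryProb W K q :=
  Finset.sum_nonneg fun a _ => outQueryProb_nonneg hW K q a

namespace IsLeafWeight

variable {W : α → PartialOracle X → ℝ} {Q : ℕ}

theorem sum_outProb (hW : IsLeafWeight W Q) (K : PartialOracle X) : ∑ a, outProb W K a = 1 := by
  calc ∑ a, outProb W K a = ∑ R, oracleProb K R * ∑ a, ∑ S, W a S * oracleMatch S R := by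
        simp only [outProb, matchProb, Finset.mul_sum]
        rw [Finset.sum_comm (s := Finset.univ (α := X → Bool))]
        refine Finset.sum_congr rfl fun a _ => ?_
        rw [Finset.sum_comm]
        simp only [mul_left_comm]
    _ = 1 := by simp only [hW.sum_eq_one, mul_one, sum_oracleProb]

theorem outProb_le_one (hW : IsLeafWeight W Q) (K : PartialOracle X) (a : α) :
    outProb W K a ≤ 1 := by
  rw [← hW.sum_outProb K]
  exact Finset.single_le_sum (fun a _ => outProb_nonneg hW.nonneg K a) (Finset.mem_univ a)

theorem queryProb_le_one (hW : IsLeafWeight W Q) (K : PartialOracle X) (q : X) :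
    queryProb W K q ≤ 1 := by
  rw [← hW.sum_outProb K]
  exact Finset.sum_le_sum fun a _ => outQueryProb_le_outProb hW.nonneg K q a

theorem sum_queryProb_le (hW : IsLeafWeight W Q) (K : PartialOracle X) :
    ∑ q, queryProb W K q ≤ Q := by
  calc ∑ q, queryProb W K q = ∑ a, ∑ S, W a S * (matchProb K S * S.size) := by
        simp only [queryProb, outQueryProb]
        rw [Finset.sum_comm]
        refine Finset.sum_congr rfl fun a _ => ?_
        rw [Finset.sum_comm]
        refine Finset.sum_congr rfl fun S _ => ?_
        rw [← Finset.mul_sum, ← Finset.mul_sum, PartialOracle.size, Finset.card_filter]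
        push_cast
        rfl
    _ ≤ ∑ a, ∑ S, W a S * (matchProb K S * Q) := by
        refine Finset.sum_le_sum fun a _ => Finset.sum_le_sum fun S _ => ?_
        by_cases h : W a S = 0
        · simp only [h, zero_mul, le_refl]
        · gcongr
          · exact hW.nonneg a S
          · exact matchProb_nonneg K S
          · exact hW.size_le a S h
    _ = Q := by
        simp only [← mul_assoc, ← Finset.sum_mul]
        exact (congrArg (· * (Q : ℝ)) (hW.sum_outProb K)).trans (one_mul _)

end IsLeafWeight

end OutputLaw

section Collision

variable {X α β γ : Type*} [Fintype α] [Fintype β]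

/-- The weight with which an encoder with leaf weights `We` has trace `S` and a decoder with leaf
weights `Wd`, which receives the codeword through the channel `N`, has trace `T`. -/
def pairWeight (We : α → PartialOracle X → ℝ) (N : α → β → ℝ) (Wd : β → PartialOracle X → ℝ)
    (S T : PartialOracle X) : ℝ := ∑ c, ∑ y, We c S * N c y * Wd y T

theorem pairWeight_nonneg {We : α → PartialOracle X → ℝ} {N : α → β → ℝ}
    {Wd : β → PartialOracle X → ℝ} (hWe : ∀ c S, 0 ≤ We c S) (hN : ∀ c y, 0 ≤ N c y)
    (hWd : ∀ y T, 0 ≤ Wd y T) (S T : PartialOracle X) : 0 ≤ pairWeight We N Wd S T :=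
  Finset.sum_nonneg fun c _ => Finset.sum_nonneg fun y _ =>
    mul_nonneg (mul_nonneg (hWe c S) (hN c y)) (hWd y T)

variable [Fintype X]

open Classical in
theorem ite_collide_le_sum (K S T : PartialOracle X) : (if Collide K S T then 1 else 0 : ℝ) ≤
    ∑ q with K q = none, (if S q ≠ none then 1 else 0) * if T q ≠ none then 1 else 0 := by
  have h_nonneg (q : X) : (0 : ℝ) ≤ (if S q ≠ none then 1 else 0) * if T q ≠ none then 1 else 0 :=
    mul_nonneg (by split_ifs <;> norm_num) (by split_ifs <;> norm_num)
  split_ifs with h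
  · obtain ⟨q, hK, hS, hT⟩ := h
    have h_single := Finset.single_le_sum (s := Finset.univ.filter fun q => K q = none)
      (fun q _ => h_nonneg q) (Finset.mem_filter.2 ⟨Finset.mem_univ q, hK⟩)
    rwa [if_pos hS, if_pos hT, one_mul] at h_single
  · exact Finset.sum_nonneg fun q _ => h_nonneg q

variable [DecidableEq X]

open Classical in
theorem sum_jointMatchProb_le (K : PartialOracle X) {A V : PartialOracle X → PartialOracle X → ℝ}
    (hA : ∀ S T, 0 ≤ A S T) (hAV : ∀ S T, A S T ≤ V S T)
    (hV : ∑ S, ∑ T, V S T * jointMatchProb K S T =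
      ∑ S, ∑ T, V S T * (matchProb K S * matchProb K T)) :
    ∑ S, ∑ T, A S T * jointMatchProb K S T ≤
      ∑ S, ∑ T, A S T * (matchProb K S * matchProb K T) +
        ∑ S, ∑ T, if Collide K S T then V S T * (matchProb K S * matchProb K T) else 0 := by
  have h_term : ∀ S T, V S T * (matchProb K S * matchProb K T) -
      V S T * jointMatchProb K S T + A S T * jointMatchProb K S T ≤
      A S T * (matchProb K S * matchProb K T) +
        if Collide K S T then V S T * (matchProb K S * matchProb K T) else 0 := by
    intro S T
    split_ifs with h
    · have h_prod := mul_nonneg (matchProb_nonneg K S) (matchProb_nonneg K T)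
      nlinarith [mul_nonneg (hA S T) h_prod,
        mul_nonneg (sub_nonneg.2 (hAV S T)) (jointMatchProb_nonneg K S T)]
    · rw [jointMatchProb_of_not_collide h]
      linarith
  have h_sum := Finset.sum_le_sum fun S (_ : S ∈ Finset.univ) =>
    Finset.sum_le_sum fun T (_ : T ∈ Finset.univ) => h_term S T
  simp only [Finset.sum_add_distrib, Finset.sum_sub_distrib, hV] at h_sum
  linarith

theorem sum_pairWeight (We : α → PartialOracle X → ℝ) (N : α → β → ℝ)
    (Wd : β → PartialOracle X → ℝ) (s t : PartialOracle X → ℝ) :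
    ∑ S, ∑ T, pairWeight We N Wd S T * (s S * t T) =
      ∑ c, (∑ S, We c S * s S) * ∑ y, N c y * ∑ T, Wd y T * t T := by
  have h_sum_T : ∀ c S, ∑ T, (∑ y, We c S * N c y * Wd y T) * (s S * t T) =
      We c S * s S * ∑ y, N c y * ∑ T, Wd y T * t T := by
    intro c S
    simp only [Finset.sum_mul, Finset.mul_sum]
    rw [Finset.sum_comm]
    refine Finset.sum_congr rfl fun y _ => Finset.sum_congr rfl fun T _ => ?_
    ring
  calc ∑ S, ∑ T, pairWeight We N Wd S T * (s S * t T)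
      = ∑ S, ∑ T, ∑ c, (∑ y, We c S * N c y * Wd y T) * (s S * t T) := by
        simp only [pairWeight, Finset.sum_mul]
    _ = ∑ S, ∑ c, ∑ T, (∑ y, We c S * N c y * Wd y T) * (s S * t T) :=
        Finset.sum_congr rfl fun S _ => Finset.sum_comm
    _ = ∑ c, ∑ S, ∑ T, (∑ y, We c S * N c y * Wd y T) * (s S * t T) := Finset.sum_comm
    _ = _ := by simp only [h_sum_T, ← Finset.sum_mul]

theorem sum_pairWeight_mul_jointMatchProb (We : α → PartialOracle X → ℝ) (N : α → β → ℝ)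
    (Wd : β → PartialOracle X → ℝ) (K : PartialOracle X) :
    ∑ S, ∑ T, pairWeight We N Wd S T * jointMatchProb K S T =
      ∑ R, oracleProb K R * ∑ c, (∑ S, We c S * oracleMatch S R) *
        ∑ y, N c y * ∑ T, Wd y T * oracleMatch T R := by
  calc ∑ S, ∑ T, pairWeight We N Wd S T * jointMatchProb K S T
      = ∑ S, ∑ T, ∑ R, pairWeight We N Wd S T *
          (oracleProb K R * (oracleMatch S R * oracleMatch T R)) := by
        simp only [jointMatchProb, Finset.mul_sum]
    _ = ∑ S, ∑ R, ∑ T, pairWeight We N Wd S T *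
          (oracleProb K R * (oracleMatch S R * oracleMatch T R)) :=
        Finset.sum_congr rfl fun S _ => Finset.sum_comm
    _ = ∑ R, ∑ S, ∑ T, pairWeight We N Wd S T *
          (oracleProb K R * (oracleMatch S R * oracleMatch T R)) := Finset.sum_comm
    _ = _ := by
        refine Finset.sum_congr rfl fun R _ => ?_
        rw [← sum_pairWeight]
        simp only [mul_left_comm (oracleProb K R), Finset.mul_sum]

variable (We : α → PartialOracle X → ℝ) (N : α → β → ℝ) (Wd : β → γ → PartialOracle X → ℝ)
  (K : PartialOracle X)

/-- The probability that the decoder outputs `b` on a codeword sent through the channel `N`, when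
encoder and decoder use the same random oracle extending `K`. -/
def commonProb (b : γ) : ℝ :=
  ∑ R, oracleProb K R * ∑ c, (∑ S, We c S * oracleMatch S R) *
    ∑ y, N c y * ∑ T, Wd y b T * oracleMatch T R

/-- The probability that the decoder outputs `b` on a codeword sent through the channel `N`, when
encoder and decoder use independent random oracles extending `K`. -/
def separateProb (b : γ) : ℝ := ∑ c, outProb We K c * ∑ y, N c y * outProb (Wd y) K b

theorem commonProb_eq_sum (b : γ) : commonProb We N Wd K b =
    ∑ S, ∑ T, pairWeight We N (fun y => Wd y b) S T * jointMatchProb K S T :=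
  (sum_pairWeight_mul_jointMatchProb We N (fun y => Wd y b) K).symm

theorem separateProb_eq_sum (b : γ) : separateProb We N Wd K b =
    ∑ S, ∑ T, pairWeight We N (fun y => Wd y b) S T * (matchProb K S * matchProb K T) :=
  (sum_pairWeight We N (fun y => Wd y b) _ _).symm

variable {We N Wd} {Q : ℕ}

theorem commonProb_le_mul (hWe : IsLeafWeight We Q) (hWd : ∀ y b T, 0 ≤ Wd y b T)
    (hN : ∀ c y, 0 ≤ N c y) (b : γ) :
    commonProb We N Wd K b ≤ 2 ^ Q * separateProb We N Wd K b := by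
  rw [commonProb_eq_sum, separateProb_eq_sum, Finset.mul_sum]
  refine Finset.sum_le_sum fun S _ => ?_
  rw [Finset.mul_sum]
  refine Finset.sum_le_sum fun T _ => ?_
  rw [mul_left_comm]
  by_cases hS : ∀ c, We c S = 0
  · simp only [pairWeight, hS, zero_mul, Finset.sum_const_zero, le_refl]
  obtain ⟨c, hc⟩ := not_forall.1 hS
  refine mul_le_mul_of_nonneg_left ((jointMatchProb_le K S T).trans ?_)
    (pairWeight_nonneg hWe.nonneg hN (fun y => hWd y b) S T)
  exact mul_le_mul_of_nonneg_right (pow_le_pow_right₀ one_le_two (hWe.size_le c S hc))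
    (mul_nonneg (matchProb_nonneg K S) (matchProb_nonneg K T))

variable [Fintype γ]

open Classical in
/-- The probability that encoder and decoder, using independent random oracles extending `K`, ask a
common query that `K` does not answer. -/
def collisionProb (We : α → PartialOracle X → ℝ) (N : α → β → ℝ) (Wd : β → γ → PartialOracle X → ℝ)
    (K : PartialOracle X) : ℝ :=
  ∑ S, ∑ T, if Collide K S T then
    pairWeight We N (fun y T => ∑ b, Wd y b T) S T * (matchProb K S * matchProb K T) else 0

theorem commonProb_le_add (hWe : IsLeafWeight We Q) {Q' : ℕ}
    (hWd : ∀ y, IsLeafWeight (Wd y) Q')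
    (hN : ∀ c y, 0 ≤ N c y) (hN_sum : ∀ c, ∑ y, N c y = 1) (b : γ) :
    commonProb We N Wd K b ≤ separateProb We N Wd K b + collisionProb We N Wd K := by
  have h_out : ∀ y, ∑ T, (∑ b, Wd y b T) * matchProb K T = 1 := fun y => by
    simp only [Finset.sum_mul]
    rw [Finset.sum_comm]
    exact (hWd y).sum_outProb K
  have h_match : ∀ y R, ∑ T, (∑ b, Wd y b T) * oracleMatch T R = 1 := fun y R => by
    simp only [Finset.sum_mul]
    rw [Finset.sum_comm]
    exact (hWd y).sum_eq_one R
  rw [commonProb_eq_sum, separateProb_eq_sum, collisionProb]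
  refine sum_jointMatchProb_le K (pairWeight_nonneg hWe.nonneg hN fun y => (hWd y).nonneg b)
    (fun S T => ?_) ?_
  · refine Finset.sum_le_sum fun c _ => Finset.sum_le_sum fun y _ => ?_
    exact mul_le_mul_of_nonneg_left
      (Finset.single_le_sum (f := fun b => Wd y b T) (fun b _ => (hWd y).nonneg b T)
        (Finset.mem_univ b)) (mul_nonneg (hWe.nonneg c S) (hN c y))
  · rw [sum_pairWeight_mul_jointMatchProb, sum_pairWeight]
    simp only [h_out, h_match, mul_one, hN_sum, hWe.sum_eq_one, sum_oracleProb]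
    exact (hWe.sum_outProb K).symm

theorem collisionProb_le_sum_pairWeight (hWe : ∀ c S, 0 ≤ We c S)
    (hWd : ∀ y b T, 0 ≤ Wd y b T) (hN : ∀ c y, 0 ≤ N c y) :
    collisionProb We N Wd K ≤ ∑ q with K q = none,
      ∑ c, outQueryProb We K q c * ∑ y, N c y * queryProb (Wd y) K q := by
  classical
  have h_query : ∀ y q, queryProb (Wd y) K q =
      ∑ T, (∑ b, Wd y b T) * (matchProb K T * if T q ≠ none then 1 else 0) := fun y q => by
    simp only [Finset.sum_mul]
    exact Finset.sum_comm
  simp only [h_query, outQueryProb]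
  simp only [← sum_pairWeight]
  rw [Finset.sum_comm, collisionProb]
  refine Finset.sum_le_sum fun S _ => ?_
  rw [Finset.sum_comm]
  refine Finset.sum_le_sum fun T _ => ?_
  have h_weight : 0 ≤ pairWeight We N (fun y T => ∑ b, Wd y b T) S T *
      (matchProb K S * matchProb K T) :=
    mul_nonneg (pairWeight_nonneg hWe hN (fun y T => Finset.sum_nonneg fun b _ => hWd y b T) S T)
      (mul_nonneg (matchProb_nonneg K S) (matchProb_nonneg K T))
  rw [← mul_boole]
  refine (mul_le_mul_of_nonneg_left (ite_collide_le_sum K S T) h_weight).trans_eq ?_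
  rw [Finset.mul_sum]
  refine Finset.sum_congr rfl fun q _ => ?_
  ring

theorem collisionProb_le_sum_outProb (hWe : ∀ c S, 0 ≤ We c S) {Q' : ℕ}
    (hWd : ∀ y, IsLeafWeight (Wd y) Q') (hN : ∀ c y, 0 ≤ N c y) (hN_sum : ∀ c, ∑ y, N c y = 1) :
    collisionProb We N Wd K ≤ ∑ c, outProb We K c := by
  classical
  have h_out : ∀ y, ∑ T, (∑ b, Wd y b T) * matchProb K T = 1 := fun y => by
    simp only [Finset.sum_mul]
    rw [Finset.sum_comm]
    exact (hWd y).sum_outProb K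
  calc collisionProb We N Wd K
      ≤ ∑ S, ∑ T, pairWeight We N (fun y T => ∑ b, Wd y b T) S T *
          (matchProb K S * matchProb K T) := by
        refine Finset.sum_le_sum fun S _ => Finset.sum_le_sum fun T _ => ?_
        split_ifs
        · exact le_rfl
        · exact mul_nonneg (pairWeight_nonneg hWe hN
            (fun y T => Finset.sum_nonneg fun b _ => (hWd y).nonneg b T) S T)
            (mul_nonneg (matchProb_nonneg K S) (matchProb_nonneg K T))
    _ = ∑ c, outProb We K c := by
        rw [sum_pairWeight]
        simp only [h_out, mul_one, hN_sum]
        rfl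

theorem collisionProb_add (We We' : α → PartialOracle X → ℝ) (N : α → β → ℝ)
    (Wd : β → γ → PartialOracle X → ℝ) :
    collisionProb (fun c S => We c S + We' c S) N Wd K =
      collisionProb We N Wd K + collisionProb We' N Wd K := by
  classical
  simp only [collisionProb, ← Finset.sum_add_distrib]
  refine Finset.sum_congr rfl fun S _ => Finset.sum_congr rfl fun T _ => ?_
  split_ifs
  · simp only [pairWeight, add_mul, Finset.sum_add_distrib]
  · exact (add_zero 0).symm

end Collision

/-! ### Rare collisions for a nearly uniform encoder -/

/-- The total variation distance of `p` from the uniform distribution, for a law `p`. -/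
def uniformExcess {n : ℕ} (p : BitString n → ℝ) : ℝ := ∑ c, max (p c - (1 / 2) ^ n) 0

theorem exists_truncation {U p : ℝ} (hU : 0 ≤ U) (hp : 0 ≤ p) :
    ∃ r, 0 ≤ r ∧ r ≤ 1 ∧ r * p ≤ U ∧ (1 - r) * p = max (p - U) 0 := by
  rcases le_or_gt p U with h | h
  · exact ⟨1, zero_le_one, le_rfl, by rwa [one_mul],
      by rw [sub_self, zero_mul, max_eq_right (sub_nonpos.2 h)]⟩
  · have hp' : p ≠ 0 := (hU.trans_lt h).ne'
    refine ⟨U / p, div_nonneg hU hp, div_le_one_of_le₀ h.le hp, ?_, ?_⟩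
    · rw [div_mul_cancel₀ _ hp']
    · rw [sub_mul, one_mul, div_mul_cancel₀ _ hp', max_eq_left (sub_nonneg.2 h.le)]

theorem rpow_mul_rpow_le {ρ a b M : ℝ} (h0 : 0 ≤ ρ) (h1 : ρ ≤ 1) (ha0 : 0 ≤ a) (ha1 : a ≤ 1)
    (hb0 : 0 ≤ b) (hb1 : b ≤ 1) (haM : a ≤ M) :
    a ^ (1 / (1 + ρ)) * b ^ (1 / (1 + ρ)) ≤ (a + b) / 2 * M ^ ((1 - ρ) / 4) := by
  have h_half : 1 / 2 ≤ 1 / (1 + ρ) := one_div_le_one_div_of_le (by linarith) (by linarith)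
  have h_exponent : 1 / 2 + (1 - ρ) / 4 ≤ 1 / (1 + ρ) := by
    rw [le_div_iff₀ (by linarith)]
    nlinarith
  have h_a : a ^ (1 / (1 + ρ)) ≤ √a * M ^ ((1 - ρ) / 4) :=
    calc a ^ (1 / (1 + ρ)) ≤ a ^ (1 / 2 + (1 - ρ) / 4) :=
          Real.rpow_le_rpow_of_exponent_ge_of_imp ha0 ha1 h_exponent fun _ h => by linarith
      _ = √a * a ^ ((1 - ρ) / 4) := by
          rw [Real.rpow_add_of_nonneg ha0 (by norm_num) (by linarith), Real.sqrt_eq_rpow]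
      _ ≤ √a * M ^ ((1 - ρ) / 4) := by
          gcongr
  have h_b : b ^ (1 / (1 + ρ)) ≤ √b := by
    rw [Real.sqrt_eq_rpow]
    exact Real.rpow_le_rpow_of_exponent_ge_of_imp hb0 hb1 h_half fun _ h => by linarith
  have h_amgm : √a * √b ≤ (a + b) / 2 := by
    nlinarith [sq_nonneg (√a - √b), Real.sq_sqrt ha0, Real.sq_sqrt hb0]
  have hM : 0 ≤ M := ha0.trans haM
  calc a ^ (1 / (1 + ρ)) * b ^ (1 / (1 + ρ)) ≤ √a * M ^ ((1 - ρ) / 4) * √b := by gcongr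
    _ = √a * √b * M ^ ((1 - ρ) / 4) := by ring
    _ ≤ (a + b) / 2 * M ^ ((1 - ρ) / 4) := by gcongr

theorem cubeNorm_le_mean_rpow {p : ℝ} (hp : 1 ≤ p) {n : ℕ} {f : BitString n → ℝ}
    (hf0 : ∀ x, 0 ≤ f x) (hf1 : ∀ x, f x ≤ 1) :
    cubeNorm p f ≤ ((1 / 2) ^ n * ∑ x, f x) ^ (1 / p) := by
  refine Real.rpow_le_rpow (sum_rpow_nonneg hf0) ?_ (by positivity)
  exact mul_le_mul_of_nonneg_left (Finset.sum_le_sum fun x _ =>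
    Real.rpow_le_self_of_le_one (hf0 x) (hf1 x) hp) (by positivity)

theorem noiseForm_le_of_mean_le {ρ M : ℝ} (h0 : 0 ≤ ρ) (h1 : ρ ≤ 1) {n : ℕ}
    {f g : BitString n → ℝ} (hf0 : ∀ x, 0 ≤ f x) (hf1 : ∀ x, f x ≤ 1) (hg0 : ∀ x, 0 ≤ g x)
    (hg1 : ∀ x, g x ≤ 1) (hM : (1 / 2) ^ n * ∑ x, f x ≤ M) :
    noiseForm ρ f g ≤
      ((1 / 2) ^ n * ∑ x, f x + (1 / 2) ^ n * ∑ x, g x) / 2 * M ^ ((1 - ρ) / 4) := by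
  have h_mean_nonneg {h : BitString n → ℝ} (hh : ∀ x, 0 ≤ h x) : 0 ≤ (1 / 2) ^ n * ∑ x, h x :=
    mul_nonneg (by positivity) (Finset.sum_nonneg fun x _ => hh x)
  have h_mean_le_one {h : BitString n → ℝ} (hh : ∀ x, h x ≤ 1) : (1 / 2) ^ n * ∑ x, h x ≤ 1 := by
    calc (1 / 2) ^ n * ∑ x, h x ≤ (1 / 2) ^ n * ∑ _x : BitString n, 1 := by
          gcongr with x
          exact hh x
      _ = 1 := by simp
  have hp : 1 ≤ 1 + ρ := by linarith
  calc noiseForm ρ f g ≤ cubeNorm (1 + ρ) f * cubeNorm (1 + ρ) g :=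
        noiseForm_le_cubeNorm_mul_cubeNorm h0 h1 hf0 hg0
    _ ≤ ((1 / 2) ^ n * ∑ x, f x) ^ (1 / (1 + ρ)) * ((1 / 2) ^ n * ∑ x, g x) ^ (1 / (1 + ρ)) :=
        mul_le_mul (cubeNorm_le_mean_rpow hp hf0 hf1) (cubeNorm_le_mean_rpow hp hg0 hg1)
          (cubeNorm_nonneg hg0) (Real.rpow_nonneg (h_mean_nonneg hf0) _)
    _ ≤ _ := rpow_mul_rpow_le h0 h1 (h_mean_nonneg hf0) (h_mean_le_one hf1) (h_mean_nonneg hg0)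
        (h_mean_le_one hg1) hM

section NoiseChannel

variable {X : Type*} [Fintype X] [DecidableEq X] {n Q : ℕ}
  {We : BitString n → PartialOracle X → ℝ} {Wd : BitString n → Bool → PartialOracle X → ℝ} {ρ : ℝ}
  (K : PartialOracle X)

theorem separateProb_noiseKernel_le {γ : Type*} [Fintype γ]
    {Wd : BitString n → γ → PartialOracle X → ℝ} (h0 : 0 ≤ ρ) (h1 : ρ ≤ 1)
    (We : BitString n → PartialOracle X → ℝ) (hWd : ∀ y, IsLeafWeight (Wd y) Q) (b : γ) :
    separateProb We (noiseKernel ρ) Wd K b ≤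
      uniformExcess (outProb We K) + ∑ y, (1 / 2) ^ n * outProb (Wd y) K b := by
  let accept (c : BitString n) : ℝ := ∑ y, noiseKernel ρ c y * outProb (Wd y) K b
  have h_nonneg (c : BitString n) : 0 ≤ accept c := Finset.sum_nonneg fun y _ =>
    mul_nonneg (noiseKernel_nonneg h0 h1 c y) (outProb_nonneg (hWd y).nonneg K b)
  have h_le_one (c : BitString n) : accept c ≤ 1 := by
    rw [← sum_noiseKernel ρ c]
    exact Finset.sum_le_sum fun y _ =>
      mul_le_of_le_one_right (noiseKernel_nonneg h0 h1 c y) ((hWd y).outProb_le_one K b)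
  have h_uniform : ∑ y, (1 / 2) ^ n * outProb (Wd y) K b = ∑ c, (1 / 2) ^ n * accept c := by
    simp only [accept, Finset.mul_sum]
    rw [Finset.sum_comm]
    refine Finset.sum_congr rfl fun y _ => ?_
    rw [← Finset.mul_sum, ← Finset.sum_mul]
    simp only [noiseKernel_comm ρ _ y, sum_noiseKernel, one_mul]
  rw [h_uniform, separateProb, uniformExcess, ← Finset.sum_add_distrib]
  refine Finset.sum_le_sum fun c _ => ?_
  nlinarith [h_nonneg c, h_le_one c, le_max_left (outProb We K c - (1 / 2) ^ n) 0,
    le_max_right (outProb We K c - (1 / 2) ^ n) 0]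

theorem sum_outQueryProb_mul_noiseKernel_le {M : ℝ} (h0 : 0 ≤ ρ) (h1 : ρ ≤ 1)
    (hWe : ∀ c S, 0 ≤ We c S) (hWe_out : ∀ c, outProb We K c ≤ (1 / 2) ^ n)
    (hWd : ∀ y, IsLeafWeight (Wd y) Q) (q : X) (hM : queryProb We K q ≤ M) :
    ∑ c, outQueryProb We K q c * ∑ y, noiseKernel ρ c y * queryProb (Wd y) K q ≤
      (queryProb We K q + ∑ y, (1 / 2) ^ n * queryProb (Wd y) K q) / 2 * M ^ ((1 - ρ) / 4) := by
  let U : ℝ := (1 / 2) ^ n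
  have hU : 0 < U := by positivity
  let f (c : BitString n) : ℝ := outQueryProb We K q c / U
  have hf0 (c : BitString n) : 0 ≤ f c := div_nonneg (outQueryProb_nonneg hWe K q c) hU.le
  have hf1 (c : BitString n) : f c ≤ 1 :=
    div_le_one_of_le₀ ((outQueryProb_le_outProb hWe K q c).trans (hWe_out c)) hU.le
  have hf_mean : U * ∑ c, f c = queryProb We K q := by
    simp only [f, ← Finset.sum_div]
    exact mul_div_cancel₀ _ hU.ne'
  have h_form : ∑ c, outQueryProb We K q c * ∑ y, noiseKernel ρ c y * queryProb (Wd y) K q =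
      noiseForm ρ f fun y => queryProb (Wd y) K q := by
    simp only [noiseForm, f, Finset.mul_sum]
    refine Finset.sum_congr rfl fun c _ => Finset.sum_congr rfl fun y _ => ?_
    field_simp
    ring
  rw [h_form, ← hf_mean, ← Finset.mul_sum]
  exact noiseForm_le_of_mean_le h0 h1 hf0 hf1 (fun y => queryProb_nonneg (hWd y).nonneg K q)
    (fun y => (hWd y).queryProb_le_one K q) (hf_mean.trans_le hM)

theorem collisionProb_le_of_outProb_le {M : ℝ} (h0 : 0 ≤ ρ) (h1 : ρ ≤ 1)
    (hWe : ∀ c S, 0 ≤ We c S) (hWe_out : ∀ c, outProb We K c ≤ (1 / 2) ^ n)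
    (hWe_query : ∑ q, queryProb We K q ≤ Q) (hWd : ∀ y, IsLeafWeight (Wd y) Q) (hM0 : 0 ≤ M)
    (hM : ∀ q, K q = none → queryProb We K q ≤ M) :
    collisionProb We (noiseKernel ρ) Wd K ≤ Q * M ^ ((1 - ρ) / 4) := by
  have hWd_query : ∑ q, ∑ y, (1 / 2) ^ n * queryProb (Wd y) K q ≤ Q := by
    rw [Finset.sum_comm]
    simp only [← Finset.mul_sum]
    calc (1 / 2 : ℝ) ^ n * ∑ y, ∑ q, queryProb (Wd y) K q
        ≤ (1 / 2) ^ n * ∑ _y : BitString n, (Q : ℝ) := by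
          gcongr with y
          exact (hWd y).sum_queryProb_le K
      _ = Q := by simp
  have h_nonneg (q : X) : 0 ≤ queryProb We K q + ∑ y, (1 / 2) ^ n * queryProb (Wd y) K q :=
    add_nonneg (queryProb_nonneg hWe K q) (Finset.sum_nonneg fun y _ =>
      mul_nonneg (by positivity) (queryProb_nonneg (hWd y).nonneg K q))
  calc collisionProb We (noiseKernel ρ) Wd K
      ≤ ∑ q with K q = none,
          (queryProb We K q + ∑ y, (1 / 2) ^ n * queryProb (Wd y) K q) / 2 * M ^ ((1 - ρ) / 4) :=
        (collisionProb_le_sum_pairWeight K hWe (fun y => (hWd y).nonneg)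
          (noiseKernel_nonneg h0 h1)).trans (Finset.sum_le_sum fun q hq =>
            sum_outQueryProb_mul_noiseKernel_le K h0 h1 hWe hWe_out hWd q
              (hM q (Finset.mem_filter.1 hq).2))
    _ ≤ ∑ q, (queryProb We K q + ∑ y, (1 / 2) ^ n * queryProb (Wd y) K q) / 2 *
          M ^ ((1 - ρ) / 4) :=
        Finset.sum_le_sum_of_subset_of_nonneg (Finset.filter_subset _ _) fun q _ _ =>
          mul_nonneg (div_nonneg (h_nonneg q) zero_le_two) (Real.rpow_nonneg hM0 _)
    _ ≤ Q * M ^ ((1 - ρ) / 4) := by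
        rw [← Finset.sum_mul, ← Finset.sum_div, Finset.sum_add_distrib]
        gcongr
        linarith

theorem collisionProb_le {M : ℝ} (h0 : 0 ≤ ρ) (h1 : ρ ≤ 1) (hWe : IsLeafWeight We Q)
    (hWd : ∀ y, IsLeafWeight (Wd y) Q) (hM0 : 0 ≤ M)
    (hM : ∀ q, K q = none → queryProb We K q ≤ M) :
    collisionProb We (noiseKernel ρ) Wd K ≤
      uniformExcess (outProb We K) + Q * M ^ ((1 - ρ) / 4) := by
  choose r hr0 hr1 hr_out hr_excess using fun c =>
    exists_truncation (U := (1 / 2 : ℝ) ^ n) (by positivity) (outProb_nonneg hWe.nonneg K c)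
  have h_split : collisionProb We (noiseKernel ρ) Wd K =
      collisionProb (fun c S => (1 - r c) * We c S) (noiseKernel ρ) Wd K +
        collisionProb (fun c S => r c * We c S) (noiseKernel ρ) Wd K := by
    rw [← collisionProb_add]
    congr 1
    funext c S
    ring
  have h_query (q : X) : queryProb (fun c S => r c * We c S) K q ≤ queryProb We K q := by
    refine Finset.sum_le_sum fun c _ => ?_
    rw [outQueryProb_mul]
    exact mul_le_of_le_one_left (outQueryProb_nonneg hWe.nonneg K q c) (hr1 c)
  rw [h_split]
  refine add_le_add ?_ ?_
  · refine (collisionProb_le_sum_outProb K (fun c S => mul_nonneg (sub_nonneg.2 (hr1 c))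
      (hWe.nonneg c S)) hWd (noiseKernel_nonneg h0 h1) (sum_noiseKernel ρ)).trans_eq ?_
    exact Finset.sum_congr rfl fun c _ => (outProb_mul ..).trans (hr_excess c)
  · refine collisionProb_le_of_outProb_le K h0 h1 (fun c S => mul_nonneg (hr0 c) (hWe.nonneg c S))
      (fun c => (outProb_mul r We K c).trans_le (hr_out c)) ?_ hWd hM0
      fun q hq => (h_query q).trans (hM q hq)
    exact (Finset.sum_le_sum fun q _ => h_query q).trans (hWe.sum_queryProb_le K)

end NoiseChannel

/-! ### Learning the heavy queries -/

section Learn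

variable {X α : Type*} [Fintype X] [DecidableEq X]

theorem outQueryProb_eq_sum_update (W : α → PartialOracle X → ℝ) (K : PartialOracle X) {q : X}
    (hq : K q = none) (p : X) (a : α) :
    outQueryProb W K p a = ∑ b, 1 / 2 * outQueryProb W (Function.update K q (some b)) p a := by
  simp only [outQueryProb, matchProb_eq_sum_update K _ hq, Finset.mul_sum, Finset.sum_mul]
  rw [Finset.sum_comm]
  refine Finset.sum_congr rfl fun b _ => Finset.sum_congr rfl fun S _ => ?_
  ring

variable [Fintype α]

theorem queryProb_eq_sum_update (W : α → PartialOracle X → ℝ) (K : PartialOracle X) {q : X}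
    (hq : K q = none) (p : X) :
    queryProb W K p = ∑ b, 1 / 2 * queryProb W (Function.update K q (some b)) p := by
  simp only [queryProb, outQueryProb_eq_sum_update W K hq, Finset.mul_sum]
  rw [Finset.sum_comm]

theorem exists_heaviest (W : α → PartialOracle X → ℝ) (K : PartialOracle X)
    (h : ∃ q, K q = none) :
    ∃ q, K q = none ∧ ∀ p, K p = none → queryProb W K p ≤ queryProb W K q := by
  obtain ⟨q₀, h₀⟩ := h
  obtain ⟨q, hq, h_max⟩ := (Finset.univ.filter fun q => K q = none).exists_max_image
    (queryProb W K) ⟨q₀, Finset.mem_filter.2 ⟨Finset.mem_univ q₀, h₀⟩⟩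
  exact ⟨q, (Finset.mem_filter.1 hq).2,
    fun p hp => h_max p (Finset.mem_filter.2 ⟨Finset.mem_univ p, hp⟩)⟩

open Classical in
/-- The extension of `K` by the answer `b` to a query outside `K` that is asked with the largest
probability; `K` itself if it answers all queries. -/
def learn (W : α → PartialOracle X → ℝ) (K : PartialOracle X) (b : Bool) : PartialOracle X :=
  if h : ∃ q, K q = none then Function.update K (exists_heaviest W K h).choose (some b) else K

open Classical in
/-- The largest probability with which a query outside `K` is asked; `0` if there is none. -/
def heaviest (W : α → PartialOracle X → ℝ) (K : PartialOracle X) : ℝ :=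
  if h : ∃ q, K q = none then queryProb W K (exists_heaviest W K h).choose else 0

/-- The expected number of distinct queries outside `K`: the potential that learning decreases. -/
def unknownQueries (W : α → PartialOracle X → ℝ) (K : PartialOracle X) : ℝ :=
  ∑ q, if K q = none then queryProb W K q else 0

theorem queryProb_le_heaviest (W : α → PartialOracle X → ℝ) (K : PartialOracle X) (q : X)
    (hq : K q = none) : queryProb W K q ≤ heaviest W K := by
  have h : ∃ q, K q = none := ⟨q, hq⟩
  rw [heaviest, dif_pos h]
  exact (exists_heaviest W K h).choose_spec.2 q hq

theorem heaviest_nonneg {W : α → PartialOracle X → ℝ} (hW : ∀ a S, 0 ≤ W a S)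
    (K : PartialOracle X) : 0 ≤ heaviest W K := by
  rw [heaviest]
  split_ifs
  · exact queryProb_nonneg hW _ _
  · exact le_rfl

theorem oracleProb_eq_sum_learn (W : α → PartialOracle X → ℝ) (K : PartialOracle X)
    (R : X → Bool) : oracleProb K R = ∑ b, 1 / 2 * oracleProb (learn W K b) R := by
  by_cases h : ∃ q, K q = none
  · simp only [learn, dif_pos h]
    exact oracleProb_eq_sum_update K (exists_heaviest W K h).choose_spec.1 R
  · simp only [learn, dif_neg h, Fintype.sum_bool]
    ring

theorem size_learn_le (W : α → PartialOracle X → ℝ) (K : PartialOracle X) (b : Bool) :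
    (learn W K b).size ≤ K.size + 1 := by
  rw [learn]
  split_ifs
  · exact size_update_le K _ _
  · exact Nat.le_succ _

theorem sum_unknownQueries_learn (W : α → PartialOracle X → ℝ) (K : PartialOracle X) :
    ∑ b, 1 / 2 * unknownQueries W (learn W K b) = unknownQueries W K - heaviest W K := by
  by_cases h : ∃ q, K q = none
  · simp only [learn, heaviest, dif_pos h]
    set q := (exists_heaviest W K h).choose
    have hq : K q = none := (exists_heaviest W K h).choose_spec.1
    simp only [unknownQueries, Finset.mul_sum]
    rw [Finset.sum_comm, ← Finset.sum_erase_add _ _ (Finset.mem_univ q),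
      ← Finset.sum_erase_add _ (fun p => if K p = none then queryProb W K p else 0)
        (Finset.mem_univ q)]
    simp only [Function.update_self, reduceCtorEq, if_false, mul_zero, Finset.sum_const_zero,
      add_zero, hq, if_true, add_sub_cancel_right]
    refine Finset.sum_congr rfl fun p hp => ?_
    simp only [Function.update_of_ne (Finset.ne_of_mem_erase hp)]
    split_ifs
    · exact (queryProb_eq_sum_update W K hq p).symm
    · simp
  · simp only [learn, heaviest, dif_neg h, Fintype.sum_bool]
    ring

theorem unknownQueries_nonneg {W : α → PartialOracle X → ℝ} (hW : ∀ a S, 0 ≤ W a S)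
    (K : PartialOracle X) : 0 ≤ unknownQueries W K :=
  Finset.sum_nonneg fun q _ => by
    split_ifs
    · exact queryProb_nonneg hW K q
    · exact le_rfl

theorem unknownQueries_le {W : α → PartialOracle X → ℝ} {Q : ℕ} (hW : IsLeafWeight W Q)
    (K : PartialOracle X) : unknownQueries W K ≤ Q := by
  refine (Finset.sum_le_sum fun q _ => ?_).trans (hW.sum_queryProb_le K)
  split_ifs
  · exact le_rfl
  · exact queryProb_nonneg hW.nonneg K q

end Learn

section Conditioning

variable {X σ : Type*} [Fintype X] [DecidableEq X] [Fintype σ]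

/-- Drawing a pair of a secret and a partial oracle with the weights `w`, and then a uniformly
random oracle that extends the partial oracle, gives the joint law `L` of oracle and secret. -/
structure IsConditioning (w : σ × PartialOracle X → ℝ) (L : (X → Bool) × σ → ℝ) : Prop where
  nonneg : ∀ z, 0 ≤ w z
  sum_mul : ∀ F : (X → Bool) × σ → ℝ,
    ∑ z, w z * ∑ R, oracleProb z.2 R * F (R, z.1) = ∑ x, L x * F x

theorem IsConditioning.sum_eq {w : σ × PartialOracle X → ℝ} {L : (X → Bool) × σ → ℝ}
    (h : IsConditioning w L) : ∑ z, w z = ∑ x, L x := by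
  simpa only [mul_one, sum_oracleProb] using h.sum_mul fun _ => 1

variable {α : Type*} [Fintype α] (W : σ → α → PartialOracle X → ℝ)

open Classical in
/-- The weights of secret and partial oracle after the heaviest query has been learned. -/
def learnStep (w : σ × PartialOracle X → ℝ) (z' : σ × PartialOracle X) : ℝ :=
  ∑ z, ∑ b, if (z.1, learn (W z.1) z.2 b) = z' then w z * (1 / 2) else 0

theorem sum_learnStep_mul (w f : σ × PartialOracle X → ℝ) :
    ∑ z, learnStep W w z * f z = ∑ z, w z * ∑ b, 1 / 2 * f (z.1, learn (W z.1) z.2 b) := by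
  simp only [learnStep, Finset.sum_mul]
  rw [Finset.sum_comm]
  refine Finset.sum_congr rfl fun z _ => ?_
  rw [Finset.sum_comm, Finset.mul_sum]
  refine Finset.sum_congr rfl fun b _ => ?_
  simp only [ite_mul, zero_mul, Finset.sum_ite_eq, Finset.mem_univ, if_true]
  ring

variable {W}

theorem exists_of_learnStep_ne_zero {w : σ × PartialOracle X → ℝ} {z' : σ × PartialOracle X}
    (h : learnStep W w z' ≠ 0) : ∃ z b, w z ≠ 0 ∧ (z.1, learn (W z.1) z.2 b) = z' := by
  obtain ⟨z, _, h⟩ := Finset.exists_ne_zero_of_sum_ne_zero h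
  obtain ⟨b, _, h⟩ := Finset.exists_ne_zero_of_sum_ne_zero h
  split_ifs at h with hz
  · exact ⟨z, b, left_ne_zero_of_mul h, hz⟩
  · exact absurd rfl h

theorem isConditioning_learnStep {w : σ × PartialOracle X → ℝ} {L : (X → Bool) × σ → ℝ}
    (h : IsConditioning w L) : IsConditioning (learnStep W w) L where
  nonneg z := Finset.sum_nonneg fun z _ => Finset.sum_nonneg fun b _ => by
    have := h.nonneg z
    split_ifs <;> positivity
  sum_mul F := by
    rw [sum_learnStep_mul, ← h.sum_mul]
    refine Finset.sum_congr rfl fun z _ => congrArg (w z * ·) ?_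
    simp only [oracleProb_eq_sum_learn (W z.1) z.2, Finset.sum_mul, Finset.mul_sum, mul_assoc]
    exact Finset.sum_comm

theorem isConditioning_iterate_learnStep {w₀ : σ × PartialOracle X → ℝ}
    {L : (X → Bool) × σ → ℝ} (h₀ : IsConditioning w₀ L) (i : ℕ) :
    IsConditioning ((learnStep W)^[i] w₀) L := by
  induction i with
  | zero => exact h₀
  | succ i ih => exact Function.iterate_succ_apply' (learnStep W) i w₀ ▸
    isConditioning_learnStep ih

theorem size_le_of_iterate_learnStep_ne_zero {w₀ : σ × PartialOracle X → ℝ} {Q₀ : ℕ}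
    (h_size : ∀ z, w₀ z ≠ 0 → z.2.size ≤ Q₀) (i : ℕ) (z : σ × PartialOracle X)
    (hz : (learnStep W)^[i] w₀ z ≠ 0) : z.2.size ≤ Q₀ + i := by
  induction i generalizing z with
  | zero => exact h_size z hz
  | succ i ih =>
    rw [Function.iterate_succ_apply'] at hz
    obtain ⟨z, b, hz_iterate, rfl⟩ := exists_of_learnStep_ne_zero hz
    exact (size_learn_le _ _ _).trans (Nat.succ_le_succ (ih z hz_iterate))

theorem sum_mul_heaviest_eq_sub (w : σ × PartialOracle X → ℝ) :
    ∑ z, w z * heaviest (W z.1) z.2 = ∑ z, w z * unknownQueries (W z.1) z.2 -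
      ∑ z, learnStep W w z * unknownQueries (W z.1) z.2 := by
  simp only [sum_learnStep_mul, sum_unknownQueries_learn, ← Finset.sum_sub_distrib]
  refine Finset.sum_congr rfl fun z _ => ?_
  ring

/-- The potential `unknownQueries` is at most `Q` and each learning step lowers it by `heaviest`. -/
theorem sum_range_heaviest_le {w₀ : σ × PartialOracle X → ℝ} {L : (X → Bool) × σ → ℝ} {Q : ℕ}
    (hW : ∀ s, IsLeafWeight (W s) Q) (h₀ : IsConditioning w₀ L) (hL : ∑ x, L x = 1) (D : ℕ) :
    ∑ i ∈ Finset.range D, ∑ z, (learnStep W)^[i] w₀ z * heaviest (W z.1) z.2 ≤ Q := by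
  simp only [sum_mul_heaviest_eq_sub, ← Function.iterate_succ_apply' (learnStep W)]
  rw [Finset.sum_range_sub' fun i =>
    ∑ z, (learnStep W)^[i] w₀ z * unknownQueries (W z.1) z.2]
  have h_first : ∑ z, w₀ z * unknownQueries (W z.1) z.2 ≤ Q := by
    calc ∑ z, w₀ z * unknownQueries (W z.1) z.2 ≤ ∑ z, w₀ z * (Q : ℝ) :=
          Finset.sum_le_sum fun z _ =>
            mul_le_mul_of_nonneg_left (unknownQueries_le (hW z.1) z.2) (h₀.nonneg z)
      _ = Q := by rw [← Finset.sum_mul, h₀.sum_eq, hL, one_mul]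
  have h_last_nonneg : 0 ≤ ∑ z, (learnStep W)^[D] w₀ z * unknownQueries (W z.1) z.2 :=
    Finset.sum_nonneg fun z _ =>
      mul_nonneg ((isConditioning_iterate_learnStep h₀ D).nonneg z)
        (unknownQueries_nonneg (hW z.1).nonneg z.2)
  exact (sub_le_self _ h_last_nonneg).trans h_first

theorem exists_light_conditioning {w₀ : σ × PartialOracle X → ℝ} {L : (X → Bool) × σ → ℝ}
    {Q Q₀ D : ℕ} (hW : ∀ s, IsLeafWeight (W s) Q) (h₀ : IsConditioning w₀ L)
    (hL : ∑ x, L x = 1) (h_size : ∀ z, w₀ z ≠ 0 → z.2.size ≤ Q₀) (hD : 0 < D) :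
    ∃ w, IsConditioning w L ∧ (∀ z, w z ≠ 0 → z.2.size ≤ Q₀ + D) ∧
      ∑ z, w z * heaviest (W z.1) z.2 ≤ Q / D := by
  have hD' : (D : ℝ) ≠ 0 := Nat.cast_ne_zero.2 hD.ne'
  obtain ⟨i, hi, h_light⟩ := Finset.exists_le_of_sum_le ⟨0, Finset.mem_range.2 hD⟩
    ((sum_range_heaviest_le hW h₀ hL D).trans_eq (b := (Q : ℝ))
      (c := ∑ _i ∈ Finset.range D, (Q : ℝ) / D)
      (by rw [Finset.sum_const, Finset.card_range, nsmul_eq_mul, mul_div_cancel₀ _ hD']))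
  exact ⟨(learnStep W)^[i] w₀, isConditioning_iterate_learnStep h₀ i, fun z hz =>
    (size_le_of_iterate_learnStep_ne_zero h_size i z hz).trans
      (Nat.add_le_add_left (Finset.mem_range.1 hi).le _), h_light⟩

end Conditioning

/-! ### A distinguisher with many samples -/

section Samples

theorem abs_sum_div_le_one {Y : Type*} {m : ℕ} (hm : 0 < m) {g : Y → ℝ} (hg : ∀ y, |g y| ≤ 1)
    (c : Fin m → Y) : |(∑ i, g (c i)) / m| ≤ 1 := by
  have hm' : (0 : ℝ) < m := Nat.cast_pos.2 hm
  rw [abs_div, abs_of_pos hm', div_le_one hm']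
  refine (Finset.abs_sum_le_sum_abs _ _).trans ((Finset.sum_le_sum fun i _ => hg (c i)).trans ?_)
  simp

variable {Y : Type*} [Fintype Y]

theorem sum_mul_exp_le {u : ℝ} (hu : 0 ≤ u) (hu_sum : ∑ _y : Y, u = 1) {g : Y → ℝ}
    (hg : ∀ y, |g y| ≤ 1) (hg_mean : ∑ y, u * g y = 0) {s : ℝ} (hs₀ : 0 ≤ s) (hs₁ : s ≤ 1) :
    ∑ y, u * Real.exp (s * g y) ≤ Real.exp (s ^ 2) := by
  have h_exp_le (y : Y) : u * Real.exp (s * g y) ≤ u + s * (u * g y) + u * s ^ 2 := by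
    have h_abs : |s * g y| ≤ 1 := by
      rw [abs_mul, abs_of_nonneg hs₀]
      exact mul_le_one₀ hs₁ (abs_nonneg _) (hg y)
    have h_taylor := (abs_le.1 (Real.abs_exp_sub_one_sub_id_le h_abs)).2
    have h_sq : (s * g y) ^ 2 ≤ s ^ 2 := by
      rw [mul_pow]
      exact mul_le_of_le_one_right (sq_nonneg s) ((sq_le_one_iff_abs_le_one _).2 (hg y))
    nlinarith
  refine (Finset.sum_le_sum fun y _ => h_exp_le y).trans ?_
  rw [Finset.sum_add_distrib, Finset.sum_add_distrib, ← Finset.mul_sum, hg_mean, ← Finset.sum_mul,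
    hu_sum]
  linarith [Real.add_one_le_exp (s ^ 2)]

theorem sum_pi_mul_exp_le {u : ℝ} (hu : 0 ≤ u) (hu_sum : ∑ _y : Y, u = 1) {g : Y → ℝ}
    (hg : ∀ y, |g y| ≤ 1) (hg_mean : ∑ y, u * g y = 0) {s : ℝ} (hs₀ : 0 ≤ s) (hs₁ : s ≤ 1)
    (m : ℕ) :
    ∑ c : Fin m → Y, u ^ m * Real.exp (s * ∑ i, g (c i)) ≤ Real.exp (s ^ 2 * m) := by
  have h_prod (c : Fin m → Y) : u ^ m * Real.exp (s * ∑ i, g (c i)) =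
      ∏ i, u * Real.exp (s * g (c i)) := by
    rw [Finset.prod_mul_distrib, ← Real.exp_sum, Finset.mul_sum, Fin.prod_const]
  simp only [h_prod]
  rw [sum_pi_prod fun _ y => u * Real.exp (s * g y), mul_comm, Real.exp_nat_mul, Fin.prod_const]
  exact pow_le_pow_left₀ (Finset.sum_nonneg fun y _ => by positivity)
    (sum_mul_exp_le hu hu_sum hg hg_mean hs₀ hs₁) m

theorem sum_pi_pow {u : ℝ} (hu_sum : ∑ _y : Y, u = 1) (m : ℕ) :
    ∑ _c : Fin m → Y, u ^ m = 1 := by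
  simpa only [Fin.prod_const, hu_sum, one_pow] using
    sum_pi_prod (ι := Fin m) fun _ (_ : Y) => u

theorem sum_mul_le_of_sum_mul_exp_le {ι : Type*} [Fintype ι] {p H : ι → ℝ} (hp : ∀ c, 0 ≤ p c)
    (hp_sum : ∑ c, p c = 1) {a : ℝ} (h : ∑ c, p c * Real.exp (H c) ≤ Real.exp a) :
    ∑ c, p c * H c ≤ a := by
  have h_jensen := convexOn_exp.map_sum_le (t := Finset.univ) (p := H) (fun c _ => hp c) hp_sum
    fun c _ => Set.mem_univ _
  exact Real.exp_le_exp.1 (h_jensen.trans h)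

/-- Chernoff and union bounds: the exponential moment of a maximum is at most the sum of the
exponential moments. -/
theorem exists_max_average {ζ : Type*} {Z : Finset ζ} (hZ : Z.Nonempty) {u : ℝ} (hu : 0 ≤ u)
    (hu_sum : ∑ _y : Y, u = 1) {g : ζ → Y → ℝ} (hg : ∀ z y, |g z y| ≤ 1)
    (hg_mean : ∀ z, ∑ y, u * g z y = 0) {s : ℝ} (hs₀ : 0 < s) (hs₁ : s ≤ 1) {m : ℕ} (hm : 0 < m)
    (h_card : (Z.card : ℝ) ≤ Real.exp (s ^ 2 * m)) :
    ∃ h : (Fin m → Y) → ℝ, (∀ c, |h c| ≤ 1) ∧ (∀ z ∈ Z, ∀ c, (∑ i, g z (c i)) / m ≤ h c) ∧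
      ∑ c, u ^ m * h c ≤ 2 * s := by
  have hsm : 0 < s * m := mul_pos hs₀ (Nat.cast_pos.2 hm)
  let h (c : Fin m → Y) : ℝ := Z.sup' hZ fun z => (∑ i, g z (c i)) / m
  have h_attained (c : Fin m → Y) : ∃ z ∈ Z, h c = (∑ i, g z (c i)) / m :=
    Finset.exists_mem_eq_sup' hZ _
  refine ⟨h, fun c => ?_, fun z hz c => Finset.le_sup' (fun z => (∑ i, g z (c i)) / m) hz, ?_⟩
  · obtain ⟨z, _, hz⟩ := h_attained c
    exact hz ▸ abs_sum_div_le_one hm (hg z) c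
  have h_exp : ∑ c, u ^ m * Real.exp (s * m * h c) ≤ Real.exp (s * m * (2 * s)) := by
    calc ∑ c, u ^ m * Real.exp (s * m * h c)
        ≤ ∑ c : Fin m → Y, ∑ z ∈ Z, u ^ m * Real.exp (s * ∑ i, g z (c i)) := by
          refine Finset.sum_le_sum fun c _ => ?_
          obtain ⟨z, hzZ, hz⟩ := h_attained c
          rw [hz, mul_assoc, mul_div_cancel₀ _ (Nat.cast_ne_zero.2 hm.ne')]
          exact Finset.single_le_sum (f := fun z => u ^ m * Real.exp (s * ∑ i, g z (c i)))
            (fun z _ => by positivity) hzZ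
      _ ≤ ∑ z ∈ Z, Real.exp (s ^ 2 * m) := by
          rw [Finset.sum_comm]
          exact Finset.sum_le_sum fun z _ =>
            sum_pi_mul_exp_le hu hu_sum (hg z) (hg_mean z) hs₀.le hs₁ m
      _ ≤ Real.exp (s ^ 2 * m) * Real.exp (s ^ 2 * m) := by
          rw [Finset.sum_const, nsmul_eq_mul]
          gcongr
      _ = Real.exp (s * m * (2 * s)) := by rw [← Real.exp_add]; ring_nf
  have h_mean := sum_mul_le_of_sum_mul_exp_le (fun _ => pow_nonneg hu m) (sum_pi_pow hu_sum m) h_exp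
  simp only [mul_left_comm _ (s * m)] at h_mean
  rw [← Finset.mul_sum] at h_mean
  exact le_of_mul_le_mul_left h_mean hsm

theorem sum_pi_prod_mul_apply {p : Y → ℝ} (hp : ∑ y, p y = 1) {m : ℕ} (f : Y → ℝ) (j : Fin m) :
    ∑ c : Fin m → Y, (∏ i, p (c i)) * f (c j) = ∑ y, p y * f y := by
  have h_prod (c : Fin m → Y) : (∏ i, p (c i)) * f (c j) =
      ∏ i, p (c i) * (if i = j then f (c i) else 1) := by
    rw [Finset.prod_mul_distrib, Finset.prod_ite_eq' Finset.univ j, if_pos (Finset.mem_univ j)]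
  simp only [h_prod]
  rw [sum_pi_prod fun i y => p y * if i = j then f y else 1, Finset.prod_eq_single j]
  · simp only [if_true]
  · intro i _ hi
    simp only [hi, if_false, mul_one, hp]
  · exact fun h => absurd (Finset.mem_univ j) h

theorem sum_pi_prod_mul_average {p : Y → ℝ} (hp : ∑ y, p y = 1) {m : ℕ} (hm : 0 < m) (f : Y → ℝ) :
    ∑ c : Fin m → Y, (∏ i, p (c i)) * ((∑ i, f (c i)) / m) = ∑ y, p y * f y := by
  have hm' : (m : ℝ) ≠ 0 := Nat.cast_ne_zero.2 hm.ne'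
  simp only [← mul_div_assoc, ← Finset.sum_div, Finset.mul_sum]
  rw [Finset.sum_comm]
  simp only [sum_pi_prod_mul_apply hp, Finset.sum_const, Finset.card_univ, Fintype.card_fin,
    nsmul_eq_mul, mul_div_cancel_left₀ _ hm']

end Samples

section ExcessTest

variable {n : ℕ}

/-- The indicator of the strings to which `p` gives more than their uniform probability, centered
under the uniform law: the optimal statistic for telling `p` from the uniform law. -/
def excessTest (p : BitString n → ℝ) (x : BitString n) : ℝ :=
  (if (1 / 2) ^ n < p x then 1 else 0) - ∑ y, (1 / 2) ^ n * if (1 / 2) ^ n < p y then 1 else 0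

theorem sum_half_pow (n : ℕ) : ∑ _x : BitString n, (1 / 2 : ℝ) ^ n = 1 := by simp

theorem abs_excessTest_le_one (p : BitString n → ℝ) (x : BitString n) : |excessTest p x| ≤ 1 := by
  have h_ite_nonneg (y : BitString n) : (0 : ℝ) ≤ if (1 / 2) ^ n < p y then 1 else 0 := by
    split_ifs <;> norm_num
  have h_ite_le (y : BitString n) : (if (1 / 2) ^ n < p y then 1 else 0 : ℝ) ≤ 1 := by
    split_ifs <;> norm_num
  have h_mean_nonneg := Finset.sum_nonneg fun y (_ : y ∈ Finset.univ) =>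
    mul_nonneg (by positivity : (0 : ℝ) ≤ (1 / 2) ^ n) (h_ite_nonneg y)
  have h_mean_le : (∑ y, (1 / 2) ^ n * if (1 / 2) ^ n < p y then 1 else 0 : ℝ) ≤ 1 :=
    (Finset.sum_le_sum fun y _ => mul_le_of_le_one_right (by positivity) (h_ite_le y)).trans_eq
      (sum_half_pow n)
  rw [excessTest, abs_le]
  constructor <;> linarith [h_ite_nonneg x, h_ite_le x]

theorem sum_half_pow_mul_excessTest (p : BitString n → ℝ) :
    ∑ x, (1 / 2) ^ n * excessTest p x = 0 := by
  simp only [excessTest, mul_sub, Finset.sum_sub_distrib, ← Finset.sum_mul, sum_half_pow, one_mul,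
    sub_self]

theorem sum_mul_excessTest {p : BitString n → ℝ} (hp : ∑ x, p x = 1) :
    ∑ x, p x * excessTest p x = uniformExcess p := by
  simp only [excessTest, uniformExcess, mul_sub, Finset.sum_sub_distrib, ← Finset.sum_mul, hp,
    one_mul]
  rw [← Finset.sum_sub_distrib]
  refine Finset.sum_congr rfl fun x _ => ?_
  split_ifs with hx
  · rw [max_eq_left (by linarith), mul_one, mul_one]
  · rw [max_eq_right (by linarith), mul_zero, mul_zero, sub_zero]

theorem uniformExcess_le_sum_mul {τ : Type*} [Fintype τ] {q : τ → ℝ} (hq : ∀ t, 0 ≤ q t)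
    (hq_sum : ∑ t, q t = 1) {p : τ → BitString n → ℝ} (hp : ∀ t x, 0 ≤ p t x)
    (hp_sum : ∀ t, ∑ x, p t x = 1) {m : ℕ} (hm : 0 < m) {h : (Fin m → BitString n) → ℝ}
    (hh : ∀ c, (∑ i, excessTest (fun x => ∑ t, q t * p t x) (c i)) / m ≤ h c) :
    uniformExcess (fun x => ∑ t, q t * p t x) ≤
      ∑ t, q t * ∑ c : Fin m → BitString n, (∏ i, p t (c i)) * h c := by
  set P : BitString n → ℝ := fun x => ∑ t, q t * p t x
  have hP_sum : ∑ x, P x = 1 := by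
    rw [Finset.sum_comm]
    simp only [← Finset.mul_sum, hp_sum, mul_one, hq_sum]
  calc uniformExcess P = ∑ t, q t * ∑ x, p t x * excessTest P x := by
        rw [← sum_mul_excessTest hP_sum]
        simp only [P, Finset.sum_mul, Finset.mul_sum, mul_assoc]
        exact Finset.sum_comm
    _ ≤ ∑ t, q t * ∑ c : Fin m → BitString n, (∏ i, p t (c i)) * h c := by
        refine Finset.sum_le_sum fun t _ => mul_le_mul_of_nonneg_left ?_ (hq t)
        rw [← sum_pi_prod_mul_average (hp_sum t) hm]
        exact Finset.sum_le_sum fun c _ => mul_le_mul_of_nonneg_left (hh c)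
          (Finset.prod_nonneg fun i _ => hp t (c i))

end ExcessTest

/-! ### The bound for one value of the security parameter -/

theorem RandAlg.sum_oracleProb_mul_toReal_run {κ : ℕ} {α : Type} (A : RandAlg κ α)
    (K : PartialOracle (BitString κ)) (a : α) :
    ∑ R, oracleProb K R * (A.run R a).toReal = outProb A.leafWeight K a := by
  simp only [toReal_run_eq_sum, outProb, matchProb, Finset.mul_sum]
  rw [Finset.sum_comm]
  simp only [mul_left_comm]

theorem exists_pmf_bool_toReal_true_eq {Y : Type*} (h : Y → ℝ) (hh : ∀ y, |h y| ≤ 1) :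
    ∃ A : Y → PMF Bool, ∀ y, (A y true).toReal = (1 + h y) / 2 := by
  have h_nonneg : ∀ y, 0 ≤ (1 + h y) / 2 := fun y => by linarith [(abs_le.1 (hh y)).1]
  have h_le_one : ∀ y, Real.toNNReal ((1 + h y) / 2) ≤ 1 := fun y => by
    rw [Real.toNNReal_le_one]
    linarith [(abs_le.1 (hh y)).2]
  refine ⟨fun y => PMF.ofFintype (fun b => if b then (Real.toNNReal ((1 + h y) / 2) : ENNReal) else
    1 - (Real.toNNReal ((1 + h y) / 2) : ENNReal)) ?_, fun y => ?_⟩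
  · have h_le_one' : (Real.toNNReal ((1 + h y) / 2) : ENNReal) ≤ 1 := by exact_mod_cast h_le_one y
    simp [add_tsub_cancel_of_le h_le_one']
  · simp [h_nonneg y]

theorem uniformExcess_eq_zero {n : ℕ} (hn : n = 0) {p : BitString n → ℝ} (hp : ∑ x, p x = 1) :
    uniformExcess p = 0 := by
  subst hn
  rw [Fintype.sum_unique] at hp
  simp [uniformExcess, hp]

theorem sum_mul_rpow_le_rpow {ι : Type*} [Fintype ι] {p f : ι → ℝ} (hp : ∀ i, 0 ≤ p i)
    (hp_sum : ∑ i, p i = 1) (hf : ∀ i, 0 ≤ f i) {b t : ℝ} (h : ∑ i, p i * f i ≤ b) (ht₀ : 0 ≤ t)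
    (ht₁ : t ≤ 1) : ∑ i, p i * f i ^ t ≤ b ^ t :=
  ((Real.concaveOn_rpow ht₀ ht₁).le_map_sum (fun i _ => hp i) hp_sum fun i _ => hf i).trans
    (Real.rpow_le_rpow (Finset.sum_nonneg fun i _ => mul_nonneg (hp i) (hf i)) h ht₀)

namespace ZeroBitCode

section KeyWeight

variable (P : ZeroBitCode) (κ : ℕ)

/-- The probability that the key generation outputs the key `z.1` and has the trace `z.2`. -/
def keyWeight (z : BitString (P.keyLen κ) × PartialOracle (BitString κ)) : ℝ :=
  (P.keyGen κ).leafWeight z.1 z.2 * (1 / 2) ^ z.2.size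

theorem toReal_setup (R : Oracle κ) (sk : BitString (P.keyLen κ)) :
    (P.setup κ (R, sk)).toReal =
      (1 / 2) ^ Fintype.card (BitString κ) * ((P.keyGen κ).run R sk).toReal := by
  classical
  rw [setup, toReal_pmf_bind_apply, Finset.sum_eq_single R]
  · congr 1
    · simp
    · rw [PMF.map_apply, tsum_eq_single sk]
      · simp
      · intro sk' h
        simp [h.symm]
  · intro R' _ h
    rw [PMF.map_apply]
    simp [h.symm]
  · simp

theorem isConditioning_keyWeight :
    IsConditioning (P.keyWeight κ) fun x => (P.setup κ x).toReal where
  nonneg z := mul_nonneg ENNReal.toReal_nonneg (by positivity)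
  sum_mul F := by
    have h_setup : ∀ R sk, (P.setup κ (R, sk)).toReal =
        ∑ K, P.keyWeight κ (sk, K) * oracleProb K R := fun R sk => by
      rw [toReal_setup, RandAlg.toReal_run_eq_sum, Finset.mul_sum]
      refine Finset.sum_congr rfl fun K _ => ?_
      rw [mul_left_comm, pow_card_mul_oracleMatch, keyWeight, mul_assoc]
    rw [Fintype.sum_prod_type, Fintype.sum_prod_type, Finset.sum_comm (γ := Oracle κ)]
    refine Finset.sum_congr rfl fun sk _ => ?_
    simp only [h_setup, Finset.mul_sum, Finset.sum_mul, ← mul_assoc]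
    exact Finset.sum_comm

end KeyWeight

variable {P : ZeroBitCode} {κ Q : ℕ}

theorem exists_light_conditioning_setup {D : ℕ} (hkey : (P.keyGen κ).QueriesAtMost Q)
    (henc : ∀ sk, (P.enc κ sk).QueriesAtMost Q) (hD : 0 < D) :
    ∃ w, IsConditioning w (fun x => (P.setup κ x).toReal) ∧
      (∀ z, w z ≠ 0 → z.2.size ≤ Q + D) ∧
      ∑ z, w z * heaviest (P.enc κ z.1).leafWeight z.2 ≤ Q / D :=
  exists_light_conditioning (W := fun sk => (P.enc κ sk).leafWeight)
    (fun sk => RandAlg.isLeafWeight_leafWeight _ (henc sk))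
    (P.isConditioning_keyWeight κ) (sum_toReal_pmf (P.setup κ))
    (fun z hz => (RandAlg.isLeafWeight_leafWeight _ hkey).size_le z.1 z.2
      (left_ne_zero_of_mul hz)) hD

/-- The distance to uniform of the encoder's output law given a key and a partial oracle, averaged
over the weights `w` of such pairs. -/
def encExcess (P : ZeroBitCode) (κ : ℕ)
    (w : BitString (P.keyLen κ) × PartialOracle (BitString κ) → ℝ) : ℝ :=
  ∑ z, w z * uniformExcess (outProb (P.enc κ z.1).leafWeight z.2)

theorem encExcess_eq_zero (henc : ∀ sk, (P.enc κ sk).QueriesAtMost Q) (hn : P.blockLen κ = 0)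
    (w : BitString (P.keyLen κ) × PartialOracle (BitString κ) → ℝ) : P.encExcess κ w = 0 :=
  Finset.sum_eq_zero fun z _ => by
    rw [uniformExcess_eq_zero hn
      ((RandAlg.isLeafWeight_leafWeight _ (henc z.1)).sum_outProb z.2), mul_zero]

section Experiments

variable {w : BitString (P.keyLen κ) × PartialOracle (BitString κ) → ℝ}

theorem toReal_completenessExp (hw : IsConditioning w fun x => (P.setup κ x).toReal)
    (ρ : unitInterval) (b : Bool) :
    (P.completenessExp κ ρ b).toReal =
      ∑ z, w z * commonProb (P.enc κ z.1).leafWeight (noiseKernel ρ)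
        (fun y => (P.dec κ z.1 y).leafWeight) z.2 b := by
  rw [completenessExp]
  simp only [toReal_pmf_bind_apply, RandAlg.toReal_run_eq_sum, toReal_noise]
  exact (hw.sum_mul fun x => ∑ c, (∑ S, (P.enc κ x.2).leafWeight c S * oracleMatch S x.1) *
    ∑ y, noiseKernel ρ c y * ∑ T, (P.dec κ x.2 y).leafWeight b T * oracleMatch T x.1).symm

theorem toReal_soundnessExp (hw : IsConditioning w fun x => (P.setup κ x).toReal)
    (y : BitString (P.blockLen κ)) (b : Bool) :
    (P.soundnessExp κ y b).toReal =
      ∑ z, w z * outProb (P.dec κ z.1 y).leafWeight z.2 b := by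
  rw [soundnessExp, toReal_pmf_bind_apply,
    ← hw.sum_mul fun x => ((P.dec κ x.2 y).run x.1 b).toReal]
  simp only [RandAlg.sum_oracleProb_mul_toReal_run]

theorem two_mul_toReal_realExp {m : ℕ} {A : (Fin m → BitString (P.blockLen κ)) → PMF Bool}
    {h : (Fin m → BitString (P.blockLen κ)) → ℝ} (hA : ∀ c, (A c true).toReal = (1 + h c) / 2)
    (hw : IsConditioning w fun x => (P.setup κ x).toReal) :
    2 * (P.realExp κ m A true).toReal = 1 + ∑ z, w z * ∑ R, oracleProb z.2 R *
      ∑ c : Fin m → BitString (P.blockLen κ),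
        (∏ i, ((P.enc κ z.1).run R (c i)).toReal) * h c := by
  have h_prod (x : Oracle κ × BitString (P.keyLen κ)) :
      ∑ c : Fin m → BitString (P.blockLen κ), ∏ i, ((P.enc κ x.2).run x.1 (c i)).toReal = 1 := by
    rw [sum_pi_prod fun _ y => ((P.enc κ x.2).run x.1 y).toReal]
    simp only [sum_toReal_pmf, Finset.prod_const_one]
  rw [realExp, hw.sum_mul fun x => ∑ c : Fin m → BitString (P.blockLen κ),
    (∏ i, ((P.enc κ x.2).run x.1 (c i)).toReal) * h c]
  simp only [toReal_pmf_bind_apply, toReal_iidSamples, hA, mul_div_assoc', mul_add, mul_one,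
    ← Finset.sum_div, Finset.sum_add_distrib, h_prod, sum_toReal_pmf]
  ring

theorem two_mul_toReal_idealExp {m : ℕ} {A : (Fin m → BitString (P.blockLen κ)) → PMF Bool}
    {h : (Fin m → BitString (P.blockLen κ)) → ℝ} (hA : ∀ c, (A c true).toReal = (1 + h c) / 2) :
    2 * (P.idealExp κ m A true).toReal =
      1 + ∑ c : Fin m → BitString (P.blockLen κ), ((1 / 2) ^ P.blockLen κ) ^ m * h c := by
  have h_uniform : ∀ c, (iidSamples (PMF.uniformOfFintype (BitString (P.blockLen κ))) m c).toReal =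
      ((1 / 2) ^ P.blockLen κ) ^ m := fun c => by simp [toReal_iidSamples]
  rw [idealExp, toReal_pmf_bind_apply]
  simp only [h_uniform, hA, mul_div_assoc', mul_add, mul_one, ← Finset.sum_div,
    Finset.sum_add_distrib, sum_pi_pow (sum_half_pow _)]
  ring

end Experiments

theorem card_le_of_forall_size_le {ℓ D : ℕ} {Z : Finset (BitString ℓ × PartialOracle (BitString κ))}
    (hZ : ∀ z ∈ Z, z.2.size ≤ D) : (Z.card : ℝ) ≤ 2 ^ ℓ * ((2 ^ κ : ℝ) ^ D * Real.exp 2) := by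
  have h_subset : Z ⊆ Finset.univ ×ˢ Finset.univ.filter fun K => K.size ≤ D := fun z hz =>
    Finset.mem_product.2 ⟨Finset.mem_univ _, Finset.mem_filter.2 ⟨Finset.mem_univ _, hZ z hz⟩⟩
  have h_card : Z.card ≤ _ := (Finset.card_le_card h_subset).trans_eq (Finset.card_product _ _)
  have h_size_card := card_size_le (X := BitString κ) D
  simp only [Finset.card_univ, Fintype.card_pi, Fintype.card_bool, Finset.prod_const,
    Fintype.card_fin, Nat.cast_pow, Nat.cast_ofNat] at h_card h_size_card
  calc (Z.card : ℝ)
      ≤ 2 ^ ℓ * ((Finset.univ.filter fun K : PartialOracle (BitString κ) =>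
          K.size ≤ D).card : ℝ) := by exact_mod_cast h_card
    _ ≤ _ := mul_le_mul_of_nonneg_left h_size_card (by positivity)

/-- The distinguisher outputs `1` with probability `(1 + h) / 2`, where `h` is the largest empirical
average of the tests for the output laws of the encoder given `z ∈ Z`. -/
theorem exists_distinguisher {D : ℕ}
    {w : BitString (P.keyLen κ) × PartialOracle (BitString κ) → ℝ}
    (hw : IsConditioning w fun x => (P.setup κ x).toReal) (h_size : ∀ z, w z ≠ 0 → z.2.size ≤ D)
    {s : ℝ} (hs₀ : 0 < s) (hs₁ : s ≤ 1) {m : ℕ} (hm : 0 < m)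
    (h_card : (2 : ℝ) ^ P.keyLen κ * ((2 ^ κ : ℝ) ^ D * Real.exp 2) ≤ Real.exp (s ^ 2 * m)) :
    ∃ A : (Fin m → BitString (P.blockLen κ)) → PMF Bool, P.encExcess κ w ≤
      2 * ((P.realExp κ m A true).toReal - (P.idealExp κ m A true).toReal) + 2 * s := by
  let Z : Finset (BitString (P.keyLen κ) × PartialOracle (BitString κ)) :=
    Finset.univ.filter fun z => z.2.size ≤ D
  have hZ : Z.Nonempty := ⟨(default, fun _ => none), by simp [Z, PartialOracle.size]⟩
  have hZ_card : (Z.card : ℝ) ≤ Real.exp (s ^ 2 * m) :=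
    (card_le_of_forall_size_le fun z hz => (Finset.mem_filter.1 hz).2).trans h_card
  obtain ⟨h, h_abs, h_max, h_mean⟩ := exists_max_average hZ (by positivity)
    (sum_half_pow (P.blockLen κ))
    (fun z => abs_excessTest_le_one (outProb (P.enc κ z.1).leafWeight z.2))
    (fun z => sum_half_pow_mul_excessTest _) hs₀ hs₁ hm hZ_card
  obtain ⟨A, hA⟩ := exists_pmf_bool_toReal_true_eq h h_abs
  have h_excess (z) (hz : w z ≠ 0) : uniformExcess (outProb (P.enc κ z.1).leafWeight z.2) ≤
      ∑ R, oracleProb z.2 R * ∑ c : Fin m → BitString (P.blockLen κ),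
        (∏ i, ((P.enc κ z.1).run R (c i)).toReal) * h c := by
    have h_out := funext ((P.enc κ z.1).sum_oracleProb_mul_toReal_run z.2)
    have h_avg := h_max z (Finset.mem_filter.2 ⟨Finset.mem_univ z, h_size z hz⟩)
    rw [← h_out] at h_avg ⊢
    exact uniformExcess_le_sum_mul (oracleProb_nonneg z.2) (sum_oracleProb z.2)
      (fun _ _ => ENNReal.toReal_nonneg) (fun R => sum_toReal_pmf _) hm h_avg
  have h_encExcess : P.encExcess κ w ≤ ∑ z, w z * ∑ R, oracleProb z.2 R *
      ∑ c : Fin m → BitString (P.blockLen κ),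
        (∏ i, ((P.enc κ z.1).run R (c i)).toReal) * h c := by
    refine Finset.sum_le_sum fun z _ => ?_
    by_cases hz : w z = 0
    · rw [hz, zero_mul, zero_mul]
    · exact mul_le_mul_of_nonneg_left (h_excess z hz) (hw.nonneg z)
  exact ⟨A, by linarith [two_mul_toReal_realExp hA hw, two_mul_toReal_idealExp hA]⟩

section Gap

variable {ρ : unitInterval} {w : BitString (P.keyLen κ) × PartialOracle (BitString κ) → ℝ}
  {δ μ : ℝ}

theorem sum_mul_outProb_dec_le (hw : IsConditioning w fun x => (P.setup κ x).toReal)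
    (hμ : ∀ x, 1 - μ ≤ (P.soundnessExp κ x false).toReal) :
    ∑ z, w z * ∑ y, (1 / 2) ^ P.blockLen κ * outProb (P.dec κ z.1 y).leafWeight z.2 true ≤ μ := by
  have h_accept (y : BitString (P.blockLen κ)) : (P.soundnessExp κ y true).toReal ≤ μ := by
    have h_sum := sum_toReal_pmf (P.soundnessExp κ y)
    rw [Fintype.sum_bool] at h_sum
    linarith [hμ y]
  calc ∑ z, w z * ∑ y, (1 / 2) ^ P.blockLen κ * outProb (P.dec κ z.1 y).leafWeight z.2 true
      = ∑ y, (1 / 2) ^ P.blockLen κ * (P.soundnessExp κ y true).toReal := by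
        simp only [toReal_soundnessExp hw, Finset.mul_sum]
        rw [Finset.sum_comm]
        simp only [mul_left_comm]
    _ ≤ ∑ _y : BitString (P.blockLen κ), (1 / 2) ^ P.blockLen κ * μ :=
        Finset.sum_le_sum fun y _ => mul_le_mul_of_nonneg_left (h_accept y) (by positivity)
    _ = μ := by rw [← Finset.sum_mul, sum_half_pow, one_mul]

theorem sum_mul_separateProb_le (hw : IsConditioning w fun x => (P.setup κ x).toReal)
    (hdec : ∀ sk x, (P.dec κ sk x).QueriesAtMost Q)
    (hμ : ∀ x, 1 - μ ≤ (P.soundnessExp κ x false).toReal) :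
    ∑ z, w z * separateProb (P.enc κ z.1).leafWeight (noiseKernel ρ)
      (fun y => (P.dec κ z.1 y).leafWeight) z.2 true ≤ P.encExcess κ w + μ := by
  refine le_trans ?_ (add_le_add_right (sum_mul_outProb_dec_le hw hμ) _)
  simp only [encExcess, ← Finset.sum_add_distrib, ← mul_add]
  exact Finset.sum_le_sum fun z _ => mul_le_mul_of_nonneg_left
    (separateProb_noiseKernel_le z.2 ρ.2.1 ρ.2.2 _
      (fun y => RandAlg.isLeafWeight_leafWeight _ (hdec z.1 y)) true) (hw.nonneg z)

theorem sum_mul_collisionProb_le (hw : IsConditioning w fun x => (P.setup κ x).toReal)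
    (henc : ∀ sk, (P.enc κ sk).QueriesAtMost Q)
    (hdec : ∀ sk x, (P.dec κ sk x).QueriesAtMost Q) {b : ℝ}
    (h_light : ∑ z, w z * heaviest (P.enc κ z.1).leafWeight z.2 ≤ b) :
    ∑ z, w z * collisionProb (P.enc κ z.1).leafWeight (noiseKernel ρ)
      (fun y => (P.dec κ z.1 y).leafWeight) z.2 ≤
        P.encExcess κ w + Q * b ^ ((1 - (ρ : ℝ)) / 4) := by
  have h0 : (0 : ℝ) ≤ ρ := ρ.2.1
  have h1 : (ρ : ℝ) ≤ 1 := ρ.2.2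
  have hWe (sk) := RandAlg.isLeafWeight_leafWeight _ (henc sk)
  have h_heaviest (z : BitString (P.keyLen κ) × PartialOracle (BitString κ)) :=
    heaviest_nonneg (hWe z.1).nonneg z.2
  have h_jensen := sum_mul_rpow_le_rpow hw.nonneg (hw.sum_eq.trans (sum_toReal_pmf _)) h_heaviest
    h_light (t := (1 - (ρ : ℝ)) / 4) (by linarith) (by linarith)
  refine le_trans ?_ (add_le_add_right (mul_le_mul_of_nonneg_left h_jensen Q.cast_nonneg) _)
  simp only [encExcess, Finset.mul_sum, ← Finset.sum_add_distrib, mul_left_comm (Q : ℝ), ← mul_add]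
  exact Finset.sum_le_sum fun z _ => mul_le_mul_of_nonneg_left
    (collisionProb_le z.2 h0 h1 (hWe z.1)
      (fun y => RandAlg.isLeafWeight_leafWeight _ (hdec z.1 y)) (h_heaviest z)
      (queryProb_le_heaviest _ z.2)) (hw.nonneg z)

theorem one_sub_sub_le_two_mul_encExcess_add (hw : IsConditioning w fun x => (P.setup κ x).toReal)
    (henc : ∀ sk, (P.enc κ sk).QueriesAtMost Q)
    (hdec : ∀ sk x, (P.dec κ sk x).QueriesAtMost Q) {b : ℝ}
    (h_light : ∑ z, w z * heaviest (P.enc κ z.1).leafWeight z.2 ≤ b)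
    (hδ : 1 - δ ≤ (P.completenessExp κ ρ true).toReal)
    (hμ : ∀ x, 1 - μ ≤ (P.soundnessExp κ x false).toReal) :
    1 - δ - μ ≤ 2 * P.encExcess κ w + Q * b ^ ((1 - (ρ : ℝ)) / 4) := by
  have h_common := Finset.sum_le_sum fun z (_ : z ∈ Finset.univ) => mul_le_mul_of_nonneg_left
    (commonProb_le_add z.2 (RandAlg.isLeafWeight_leafWeight _ (henc z.1))
      (fun y => RandAlg.isLeafWeight_leafWeight _ (hdec z.1 y))
      (noiseKernel_nonneg ρ.2.1 ρ.2.2) (sum_noiseKernel ρ) true) (hw.nonneg z)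
  simp only [mul_add, Finset.sum_add_distrib] at h_common
  rw [← toReal_completenessExp hw] at h_common
  linarith [sum_mul_separateProb_le (ρ := ρ) hw hdec hμ,
    sum_mul_collisionProb_le (ρ := ρ) hw henc hdec h_light]

theorem one_sub_le_two_pow_mul_encExcess_add (hw : IsConditioning w fun x => (P.setup κ x).toReal)
    (henc : ∀ sk, (P.enc κ sk).QueriesAtMost Q)
    (hdec : ∀ sk x, (P.dec κ sk x).QueriesAtMost Q)
    (hδ : 1 - δ ≤ (P.completenessExp κ ρ true).toReal)
    (hμ : ∀ x, 1 - μ ≤ (P.soundnessExp κ x false).toReal) :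
    1 - δ ≤ 2 ^ Q * (P.encExcess κ w + μ) := by
  have h_common := Finset.sum_le_sum fun z (_ : z ∈ Finset.univ) => mul_le_mul_of_nonneg_left
    (commonProb_le_mul z.2 (RandAlg.isLeafWeight_leafWeight _ (henc z.1))
      (fun y => (RandAlg.isLeafWeight_leafWeight _ (hdec z.1 y)).nonneg)
      (noiseKernel_nonneg ρ.2.1 ρ.2.2) true) (hw.nonneg z)
  simp only [mul_left_comm _ ((2 : ℝ) ^ Q), ← Finset.mul_sum] at h_common
  rw [← toReal_completenessExp hw] at h_common
  exact hδ.trans (h_common.trans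
    (mul_le_mul_of_nonneg_left (sum_mul_separateProb_le hw hdec hμ) (by positivity)))

end Gap

theorem exists_adversary_bound {ρ : unitInterval} {D : ℕ} (hkey : (P.keyGen κ).QueriesAtMost Q)
    (henc : ∀ sk, (P.enc κ sk).QueriesAtMost Q)
    (hdec : ∀ sk x, (P.dec κ sk x).QueriesAtMost Q) (hD : 0 < D)
    {s : ℝ} (hs₀ : 0 < s) (hs₁ : s ≤ 1) {m : ℕ} (hm : 0 < m)
    (h_card : (2 : ℝ) ^ P.keyLen κ * ((2 ^ κ : ℝ) ^ (Q + D) * Real.exp 2) ≤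
      Real.exp (s ^ 2 * m)) :
    ∃ A : (Fin m → BitString (P.blockLen κ)) → PMF Bool, ∀ δ ε μ : ℝ,
      |(P.realExp κ m A true).toReal - (P.idealExp κ m A true).toReal| ≤ ε →
      1 - δ ≤ (P.completenessExp κ ρ true).toReal →
      (∀ x, 1 - μ ≤ (P.soundnessExp κ x false).toReal) →
      ∃ T : ℝ, T ≤ 2 * ε + 2 * s ∧ (P.blockLen κ = 0 → T = 0) ∧
        1 - δ - μ ≤ 2 * T + Q * (Q / D : ℝ) ^ ((1 - (ρ : ℝ)) / 4) ∧
        1 - δ ≤ 2 ^ Q * (T + μ) := by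
  obtain ⟨w, hw, h_size, h_light⟩ := exists_light_conditioning_setup hkey henc hD
  obtain ⟨A, hA⟩ := exists_distinguisher hw h_size hs₀ hs₁ hm h_card
  refine ⟨A, fun δ ε μ hε hδ hμ => ⟨P.encExcess κ w, ?_, fun hn => encExcess_eq_zero henc hn w,
    one_sub_sub_le_two_mul_encExcess_add hw henc hdec h_light hδ hμ,
    one_sub_le_two_pow_mul_encExcess_add hw henc hdec hδ hμ⟩⟩
  linarith [le_of_abs_le hε]

end ZeroBitCode

/-! ### Asymptotics -/

section GapBound

variable {κ Q n : ℕ} {ε d e : ℝ}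

/-- The lower bound of the theorem on `d = δ + μ`, with the exponent `e` and `C = 4`. -/
def GapBound (κ Q n : ℕ) (ε d e : ℝ) : Prop :=
  d ≥ 1 - (Q : ℝ) ^ 2 * (κ : ℝ) ^ (-e) - 4 * ((Q : ℝ) ^ 2 * √(ε * n))

theorem gapBound_of_one_le_rpow (hd : 0 ≤ d) (h : 1 ≤ (Q : ℝ) ^ 2 * (κ : ℝ) ^ (-e)) :
    GapBound κ Q n ε d e := by
  have h_sqrt : 0 ≤ 4 * ((Q : ℝ) ^ 2 * √(ε * n)) := by positivity
  rw [GapBound]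
  linarith

theorem gapBound_of_one_le_sqrt (hQ : 1 ≤ Q) (hd : 0 ≤ d) (h : 1 ≤ √(ε * n)) :
    GapBound κ Q n ε d e := by
  have hQ_sq : (1 : ℝ) ≤ (Q : ℝ) ^ 2 := one_le_pow₀ (Nat.one_le_cast.2 hQ)
  have h_rpow : 0 ≤ (Q : ℝ) ^ 2 * (κ : ℝ) ^ (-e) := by positivity
  rw [GapBound]
  linarith [one_le_mul_of_one_le_of_one_le hQ_sq h]

theorem gapBound_zero (hQ : 1 ≤ Q) (hd : 0 ≤ d) : GapBound κ Q n ε d 0 :=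
  gapBound_of_one_le_rpow hd (by
    rw [neg_zero, Real.rpow_zero, mul_one]
    exact one_le_pow₀ (Nat.one_le_cast.2 hQ))

theorem le_two_mul_sqrt_add_or_one_le_sqrt {s T : ℝ} (hε : 0 ≤ ε) (hs : 0 ≤ s)
    (hT : T ≤ 2 * ε + s) (hn : n = 0 → T = 0) : T ≤ 2 * √(ε * n) + s ∨ 1 ≤ √(ε * n) := by
  rcases Nat.eq_zero_or_pos n with h | h
  · left
    rw [hn h]
    positivity
  have hn_one : (1 : ℝ) ≤ n := Nat.one_le_cast.2 h
  rcases le_total ε 1 with hε_one | hε_one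
  · have h_le_sqrt : ε ≤ √(ε * n) := Real.le_sqrt_of_sq_le (by nlinarith)
    exact Or.inl (by linarith)
  · exact Or.inr (Real.one_le_sqrt.2 (one_le_mul_of_one_le_of_one_le hε_one hn_one))

theorem one_le_sq_mul_rpow_neg {k : ℕ} {θ : ℝ} (hκ : 1 ≤ κ) (hθ : θ ≤ 1) (hQ : κ ^ k ≤ Q) :
    1 ≤ (Q : ℝ) ^ 2 * (κ : ℝ) ^ (-(k * θ)) := by
  have hκ_one : (1 : ℝ) ≤ κ := Nat.one_le_cast.2 hκ
  have hκ_pos : (0 : ℝ) < κ := zero_lt_one.trans_le hκ_one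
  rw [Real.rpow_neg hκ_pos.le, ← div_eq_mul_inv, one_le_div (Real.rpow_pos_of_pos hκ_pos _)]
  calc (κ : ℝ) ^ (k * θ) ≤ (κ : ℝ) ^ (k : ℝ) :=
        Real.rpow_le_rpow_of_exponent_le hκ_one (mul_le_of_le_one_right k.cast_nonneg hθ)
    _ = (κ ^ k : ℕ) := by rw [Real.rpow_natCast, Nat.cast_pow]
    _ ≤ Q := Nat.cast_le.2 hQ
    _ ≤ (Q : ℝ) ^ 2 := le_self_pow₀ (Nat.one_le_cast.2 ((Nat.one_le_pow k κ hκ).trans hQ))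
        two_ne_zero

theorem inv_pow_succ_le_rpow_neg_div {k : ℕ} {θ : ℝ} (hκ : 16 ≤ κ) (hθ : θ ≤ 1) :
    ((κ : ℝ) ^ (k + 1))⁻¹ ≤ (κ : ℝ) ^ (-(k * θ)) / 16 := by
  have hκ' : (16 : ℝ) ≤ κ := Nat.ofNat_le_cast.2 hκ
  have h_rpow : ((κ : ℝ) ^ k)⁻¹ ≤ (κ : ℝ) ^ (-(k * θ)) := by
    rw [← Real.rpow_natCast, ← Real.rpow_neg κ.cast_nonneg]
    exact Real.rpow_le_rpow_of_exponent_le (by linarith)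
      (neg_le_neg (mul_le_of_le_one_right k.cast_nonneg hθ))
  rw [pow_succ, mul_inv, div_eq_mul_inv]
  exact mul_le_mul h_rpow (inv_anti₀ (by norm_num) hκ') (by positivity) (by positivity)

theorem div_pow_rpow_le {k : ℕ} {θ : ℝ} (hκ : 1 ≤ κ) (hθ : 0 ≤ θ) (hQ : Q ≤ κ ^ k) :
    (Q / (κ ^ (17 * k) : ℕ) : ℝ) ^ (θ / 4) ≤ ((κ : ℝ) ^ (-(k * θ))) ^ 4 := by
  have hκ_pos : (0 : ℝ) < κ := Nat.cast_pos.2 hκ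
  have h_base : (Q / (κ ^ (17 * k) : ℕ) : ℝ) ≤ (κ : ℝ) ^ (-((16 * k : ℕ) : ℝ)) := by
    rw [Nat.cast_pow, div_le_iff₀ (by positivity), Real.rpow_neg hκ_pos.le, Real.rpow_natCast,
      show 17 * k = 16 * k + k by ring, pow_add, inv_mul_cancel_left₀ (by positivity)]
    exact_mod_cast hQ
  refine (Real.rpow_le_rpow (by positivity) h_base (by linarith)).trans_eq ?_
  rw [← Real.rpow_mul hκ_pos.le, ← Real.rpow_natCast (_ ^ _) 4, ← Real.rpow_mul hκ_pos.le]
  congr 1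
  push_cast
  ring

variable {δ μ T : ℝ}

/-- With one query per execution the exponent can be raised until `κ ^ (-e) = 3 / 4`. -/
theorem exists_gapBound_one (hκ : 1 < κ) (he : 3 / 4 ≤ (κ : ℝ) ^ (-e)) (hδ : 0 ≤ δ)
    (hT : T ≤ 2 * √(ε * n) + 1 / 8) (h : 1 - δ ≤ 2 * (T + μ)) :
    ∃ e', e ≤ e' ∧ GapBound κ 1 n ε (δ + μ) e' := by
  have hκ' : (1 : ℝ) < κ := Nat.one_lt_cast.2 hκ
  have h_rpow : (κ : ℝ) ^ (-Real.logb κ (4 / 3)) = 3 / 4 := by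
    rw [Real.rpow_neg κ.cast_nonneg,
      Real.rpow_logb (zero_lt_one.trans hκ') hκ'.ne' (by norm_num)]
    norm_num
  refine ⟨Real.logb κ (4 / 3), ?_, ?_⟩
  · rwa [← h_rpow, Real.rpow_le_rpow_left_iff hκ', neg_le_neg_iff] at he
  · rw [GapBound, h_rpow, Nat.cast_one]
    linarith [Real.sqrt_nonneg (ε * n)]

theorem gapBound_of_rpow_lt (hQ : 1 ≤ Q) (he : (κ : ℝ) ^ (-e) < 3 / 4)
    (hT : T ≤ 2 * √(ε * n) + (κ : ℝ) ^ (-e) / 8)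
    (h : 1 - δ - μ ≤ 2 * T + Q * ((κ : ℝ) ^ (-e)) ^ 4) : GapBound κ Q n ε (δ + μ) e := by
  have hQ' : (1 : ℝ) ≤ Q := Nat.one_le_cast.2 hQ
  rw [GapBound]
  set y : ℝ := (κ : ℝ) ^ (-e)
  set r : ℝ := √(ε * n)
  have hy : 0 ≤ y := by positivity
  have hQ_sq : (Q : ℝ) ≤ (Q : ℝ) ^ 2 := le_self_pow₀ hQ' two_ne_zero
  have h_cube : y ^ 3 ≤ 1 / 2 := (pow_le_pow_left₀ hy he.le 3).trans (by norm_num)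
  have h_fourth : (Q : ℝ) * y ^ 4 ≤ Q ^ 2 * (y / 2) :=
    mul_le_mul hQ_sq (by nlinarith) (by positivity) (by positivity)
  have hy_le : y ≤ Q ^ 2 * y := le_mul_of_one_le_left hy (hQ'.trans hQ_sq)
  have hr_le : r ≤ Q ^ 2 * r := le_mul_of_one_le_left (Real.sqrt_nonneg _) (hQ'.trans hQ_sq)
  linarith

theorem exists_gapBound {k : ℕ} {θ : ℝ} (hκ : 16 ≤ κ) (hQ : 1 ≤ Q) (hQk : Q ≤ κ ^ k)
    (hθ₀ : 0 ≤ θ) (hθ₁ : θ ≤ 1) (hε : 0 ≤ ε) (hδ : 0 ≤ δ) (hμ : 0 ≤ μ)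
    (hT : T ≤ 2 * ε + 2 * ((κ : ℝ) ^ (k + 1))⁻¹) (hn : n = 0 → T = 0)
    (h_gap : 1 - δ - μ ≤ 2 * T + Q * (Q / (κ ^ (17 * k) : ℕ) : ℝ) ^ (θ / 4))
    (h_crude : 1 - δ ≤ 2 ^ Q * (T + μ)) :
    ∃ e, k * θ ≤ e ∧ GapBound κ Q n ε (δ + μ) e := by
  have hκ_one : 1 < κ := by omega
  have h_dev := inv_pow_succ_le_rpow_neg_div (k := k) hκ hθ₁
  rcases le_or_gt 1 ((Q : ℝ) ^ 2 * (κ : ℝ) ^ (-(k * θ))) with h_one_le | h_lt_one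
  · exact ⟨_, le_rfl, gapBound_of_one_le_rpow (add_nonneg hδ hμ) h_one_le⟩
  obtain hT' | h_sqrt := le_two_mul_sqrt_add_or_one_le_sqrt hε (by positivity) hT hn
  swap
  · exact ⟨_, le_rfl, gapBound_of_one_le_sqrt hQ (add_nonneg hδ hμ) h_sqrt⟩
  rcases le_or_gt (3 / 4) ((κ : ℝ) ^ (-(k * θ))) with h_large | h_small
  · obtain rfl : Q = 1 := by
      by_contra hQ_ne
      have hQ_two : (2 : ℝ) ≤ Q := by exact_mod_cast (by omega : 2 ≤ Q)
      nlinarith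
    rw [Nat.cast_one, one_pow, one_mul] at h_lt_one
    rw [pow_one] at h_crude
    exact exists_gapBound_one hκ_one h_large hδ (by linarith) h_crude
  · have h_fourth := mul_le_mul_of_nonneg_left (div_pow_rpow_le hκ_one.le hθ₀ hQk)
      (Q.cast_nonneg (α := ℝ))
    exact ⟨_, le_rfl, gapBound_of_rpow_lt (T := T) hQ h_small (by linarith) (by linarith)⟩

end GapBound

/-- The exponent at `κ` is taken for the largest `k ≤ κ` that is admissible at `κ`. -/
theorem exists_exponent_of_forall_eventually {θ : ℕ → ℝ} (hθ : ∀ κ, 0 ≤ θ κ) {B : ℕ → ℝ → Prop}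
    (h_zero : ∀ κ, B κ 0) (h : ∀ k : ℕ, ∀ᶠ κ in atTop, ∃ e, k * θ κ ≤ e ∧ B κ e) :
    ∃ η : ℕ → ℝ, (∀ κ, 0 ≤ η κ) ∧ θ =o[atTop] η ∧ ∀ κ, B κ (η κ) := by
  classical
  let admissible (κ k : ℕ) : Prop := ∃ e, k * θ κ ≤ e ∧ B κ e
  let best (κ : ℕ) : ℕ := Nat.findGreatest (admissible κ) κ
  have h_best (κ : ℕ) : admissible κ (best κ) := Nat.findGreatest_spec (Nat.zero_le κ)
    ⟨0, by rw [Nat.cast_zero, zero_mul], h_zero κ⟩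
  choose η hη h_bound using h_best
  have hη_nonneg (κ : ℕ) : 0 ≤ η κ := (mul_nonneg (Nat.cast_nonneg _) (hθ κ)).trans (hη κ)
  refine ⟨η, hη_nonneg, isLittleO_iff.2 fun c hc => ?_, h_bound⟩
  obtain ⟨k, hk⟩ := exists_nat_gt (1 / c)
  filter_upwards [h k, eventually_ge_atTop k] with κ h_admissible hkκ
  have hk_best : (k : ℝ) ≤ best κ := Nat.cast_le.2 (Nat.le_findGreatest hkκ h_admissible)
  rw [Real.norm_of_nonneg (hθ κ), Real.norm_of_nonneg (hη_nonneg κ)]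
  calc θ κ ≤ c * k * θ κ := le_mul_of_one_le_left (hθ κ) ((div_lt_iff₀' hc).1 hk).le
    _ = c * (k * θ κ) := mul_assoc _ _ _
    _ ≤ c * η κ := mul_le_mul_of_nonneg_left
        ((mul_le_mul_of_nonneg_right hk_best (hθ κ)).trans (hη κ)) hc.le

section SampleSize

/-- The number of samples for the exponent `k`, polynomial in `κ`: enough to estimate, up to
`κ ^ (-(k + 1))`, one average for each key of length at most `p κ` and each partial oracle with at
most `κ ^ k + κ ^ (17 * k)` answers. -/
def sampleSize (p : Polynomial ℕ) (k κ : ℕ) : ℕ :=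
  κ ^ (2 * (k + 1)) * (p.eval κ + κ * (κ ^ k + κ ^ (17 * k)) + 2)

theorem polyBounded_sampleSize (p : Polynomial ℕ) (k : ℕ) : PolyBounded (sampleSize p k) :=
  ⟨Polynomial.X ^ (2 * (k + 1)) * (p + Polynomial.X * (Polynomial.X ^ k +
    Polynomial.X ^ (17 * k)) + 2), fun κ => le_of_eq (by simp [sampleSize])⟩

theorem sampleSize_pos (p : Polynomial ℕ) (k : ℕ) {κ : ℕ} (hκ : 0 < κ) : 0 < sampleSize p k κ :=
  Nat.mul_pos (Nat.pow_pos hκ) (Nat.succ_pos _)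

theorem two_pow_mul_le_exp_sampleSize {p : Polynomial ℕ} {κ Q ℓ k : ℕ} (hκ : 0 < κ)
    (hℓ : ℓ ≤ p.eval κ) (hQ : Q ≤ κ ^ k) :
    (2 : ℝ) ^ ℓ * ((2 ^ κ : ℝ) ^ (Q + κ ^ (17 * k)) * Real.exp 2) ≤
      Real.exp (((κ : ℝ) ^ (k + 1))⁻¹ ^ 2 * sampleSize p k κ) := by
  have hκ' : (κ : ℝ) ≠ 0 := Nat.cast_ne_zero.2 hκ.ne'
  have h_two_le : (2 : ℝ) ≤ Real.exp 1 := by linarith [Real.add_one_le_exp (1 : ℝ)]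
  have h_exponent : ((κ : ℝ) ^ (k + 1))⁻¹ ^ 2 * sampleSize p k κ =
      ((p.eval κ + κ * (κ ^ k + κ ^ (17 * k)) + 2 : ℕ) : ℝ) := by
    rw [sampleSize, Nat.cast_mul, ← mul_assoc, Nat.cast_pow, inv_pow, ← pow_mul,
      mul_comm (k + 1) 2, inv_mul_cancel₀ (pow_ne_zero _ hκ'), one_mul]
  calc (2 : ℝ) ^ ℓ * ((2 ^ κ : ℝ) ^ (Q + κ ^ (17 * k)) * Real.exp 2)
      ≤ Real.exp 1 ^ ℓ * ((Real.exp 1 ^ κ) ^ (Q + κ ^ (17 * k)) * Real.exp 2) := by gcongr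
    _ = Real.exp ((ℓ + κ * (Q + κ ^ (17 * k)) + 2 : ℕ) : ℝ) := by
        simp only [← Real.exp_nat_mul, ← Real.exp_add]
        congr 1
        push_cast
        ring
    _ ≤ _ := by
        rw [h_exponent, Real.exp_le_exp, Nat.cast_le]
        gcongr

end SampleSize

theorem toReal_pmf_apply_le_one {α : Type*} (p : PMF α) (a : α) : (p a).toReal ≤ 1 :=
  ENNReal.toReal_le_of_le_ofReal zero_le_one (by rw [ENNReal.ofReal_one]; exact p.coe_le_one a)

namespace ZeroBitCode

theorem exists_adversary_gapBound {P : ZeroBitCode} {κ Q k : ℕ} {p : Polynomial ℕ}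
    (ρ : unitInterval) (hκ : 16 ≤ κ) (hQ : 1 ≤ Q) (hp : P.keyLen κ ≤ p.eval κ)
    (hkey : (P.keyGen κ).QueriesAtMost Q) (henc : ∀ sk, (P.enc κ sk).QueriesAtMost Q)
    (hdec : ∀ sk x, (P.dec κ sk x).QueriesAtMost Q) :
    ∃ A : (Fin (sampleSize p k κ) → BitString (P.blockLen κ)) → PMF Bool,
      ∀ δ ε μ : ℝ, 0 ≤ δ → 0 ≤ μ →
        |(P.realExp κ _ A true).toReal - (P.idealExp κ _ A true).toReal| ≤ ε →
        1 - δ ≤ (P.completenessExp κ ρ true).toReal →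
        (∀ x, 1 - μ ≤ (P.soundnessExp κ x false).toReal) →
        ∃ e, k * (1 - (ρ : ℝ)) ≤ e ∧ GapBound κ Q (P.blockLen κ) ε (δ + μ) e := by
  have hκ_pos : 0 < κ := by omega
  have hθ₁ : 1 - (ρ : ℝ) ≤ 1 := sub_le_self 1 ρ.2.1
  rcases le_or_gt Q (κ ^ k) with hQk | hQk
  · obtain ⟨A, hA⟩ := exists_adversary_bound (ρ := ρ) hkey henc hdec (Nat.pow_pos hκ_pos)
      (s := ((κ : ℝ) ^ (k + 1))⁻¹) (by positivity)
      (inv_le_one_of_one_le₀ (one_le_pow₀ (Nat.one_le_cast.2 hκ_pos))) (sampleSize_pos p k hκ_pos)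
      (two_pow_mul_le_exp_sampleSize hκ_pos hp hQk)
    refine ⟨A, fun δ ε μ hδ₀ hμ₀ hε hδ hμ => ?_⟩
    obtain ⟨T, hT, hn, h_gap, h_crude⟩ := hA δ ε μ hε hδ hμ
    exact exists_gapBound hκ hQ hQk (sub_nonneg.2 ρ.2.2) hθ₁ ((abs_nonneg _).trans hε) hδ₀ hμ₀ hT
      hn h_gap h_crude
  · exact ⟨fun _ => PMF.pure true, fun δ ε μ hδ₀ hμ₀ _ _ _ => ⟨_, le_rfl,
      gapBound_of_one_le_rpow (add_nonneg hδ₀ hμ₀) (one_le_sq_mul_rpow_neg hκ_pos hθ₁ hQk.le)⟩⟩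

variable {P : ZeroBitCode} {ρ : ℕ → unitInterval} {δ ε μ : ℕ → ℝ} {Q : ℕ → ℕ}

theorem IsComplete.nonneg (h : P.IsComplete ρ δ) (κ : ℕ) : 0 ≤ δ κ := by
  linarith [h κ, toReal_pmf_apply_le_one (P.completenessExp κ (ρ κ)) true]

theorem IsSound.nonneg (h : P.IsSound μ) (κ : ℕ) : 0 ≤ μ κ := by
  linarith [h κ fun _ => false, toReal_pmf_apply_le_one (P.soundnessExp κ fun _ => false) false]

theorem IsPRC.eventually_exists_gapBound (hP : P.IsPRC ρ δ ε μ) (hQ : ∀ κ, 1 ≤ Q κ)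
    (hPQ : P.QueriesAtMost Q) (k : ℕ) :
    ∀ᶠ κ in atTop, ∃ e, k * (1 - (ρ κ : ℝ)) ≤ e ∧
      GapBound κ (Q κ) (P.blockLen κ) (ε κ) (δ κ + μ κ) e := by
  obtain ⟨p, hp⟩ := hP.polyKey
  have h_adversary (κ : ℕ) (hκ : 16 ≤ κ) := exists_adversary_gapBound (k := k) (ρ κ) hκ (hQ κ)
    (hp κ) (hPQ κ).1 (fun sk => ((hPQ κ).2 sk).1) fun sk => ((hPQ κ).2 sk).2
  choose A hA using h_adversary
  filter_upwards [hP.pseudorandom _ (polyBounded_sampleSize p k) fun κ =>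
    if hκ : 16 ≤ κ then A κ hκ else fun _ => PMF.pure true, eventually_ge_atTop 16] with κ hε hκ
  rw [dif_pos hκ] at hε
  exact hA κ hκ _ _ _ (hP.complete.nonneg κ) (hP.sound.nonneg κ) hε (hP.complete κ) (hP.sound κ)

theorem IsPRC.exists_exponent (hP : P.IsPRC ρ δ ε μ) (hQ : ∀ κ, 1 ≤ Q κ)
    (hPQ : P.QueriesAtMost Q) :
    ∃ η : ℕ → ℝ, (∀ κ, 0 ≤ η κ) ∧ (fun κ => 1 - (ρ κ : ℝ)) =o[atTop] η ∧
      ∀ κ, GapBound κ (Q κ) (P.blockLen κ) (ε κ) (δ κ + μ κ) (η κ) :=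
  exists_exponent_of_forall_eventually (fun κ => sub_nonneg.2 (ρ κ).2.2)
    (fun κ => gapBound_zero (hQ κ) (add_nonneg (hP.complete.nonneg κ) (hP.sound.nonneg κ)))
    (hP.eventually_exists_gapBound hQ hPQ)

end ZeroBitCode

section Negligible

theorem PolyBounded.exists_real {f : ℕ → ℕ} (hf : PolyBounded f) :
    ∃ p : Polynomial ℝ, ∀ κ : ℕ, (f κ : ℝ) ≤ p.eval (κ : ℝ) := by
  obtain ⟨p, hp⟩ := hf
  refine ⟨p.map (Nat.castRingHom ℝ), fun κ => ?_⟩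
  rw [Polynomial.eval_natCast_map]
  exact Nat.cast_le.2 (hp κ)

theorem Negligible.polyBounded_mul {f : ℕ → ℕ} {g : ℕ → ℝ} (hf : PolyBounded f)
    (hg : Negligible g) : Negligible fun κ => (f κ : ℝ) * g κ := by
  obtain ⟨p, hp⟩ := hf.exists_real
  refine (SuperpolynomialDecay.polynomial_mul hg p).trans_abs_le fun κ => ?_
  rw [abs_mul, abs_mul, Nat.abs_cast]
  exact mul_le_mul_of_nonneg_right ((hp κ).trans (le_abs_self _)) (abs_nonneg _)

theorem Negligible.polyBounded_sq_mul {f : ℕ → ℕ} {g : ℕ → ℝ} (hf : PolyBounded f)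
    (hg : Negligible g) : Negligible fun κ => (f κ : ℝ) ^ 2 * g κ := by
  simpa only [sq, mul_assoc] using (hg.polyBounded_mul hf).polyBounded_mul hf

theorem Negligible.sqrt {g : ℕ → ℝ} (hg : Negligible g) : Negligible fun κ => √(g κ) := by
  intro N
  have h_tendsto := (Real.continuous_sqrt.tendsto _).comp (hg (2 * N))
  rw [Real.sqrt_zero] at h_tendsto
  refine h_tendsto.congr fun κ => ?_
  rw [Function.comp_apply, pow_mul', Real.sqrt_mul (sq_nonneg _), Real.sqrt_sq (by positivity)]

theorem negligible_rpow_neg {η : ℕ → ℝ} (h : Tendsto η atTop atTop) :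
    Negligible fun κ => (κ : ℝ) ^ (-η κ) := by
  intro N
  refine squeeze_zero' (Eventually.of_forall fun κ => by positivity) ?_
    (tendsto_inv_atTop_nhds_zero_nat (𝕜 := ℝ))
  filter_upwards [h.eventually_ge_atTop (N + 1), eventually_ge_atTop 1] with κ hη hκ
  have hκ_one : (1 : ℝ) ≤ κ := Nat.one_le_cast.2 hκ
  rw [← Real.rpow_natCast, ← Real.rpow_add (zero_lt_one.trans_le hκ_one), ← Real.rpow_neg_one]
  exact Real.rpow_le_rpow_of_exponent_le hκ_one (by linarith)

theorem tendsto_atTop_of_isLittleO {θ η : ℕ → ℝ} (hη : ∀ κ, 0 ≤ η κ) (h : θ =o[atTop] η) {c : ℝ}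
    (hc : 0 < c) (hθ : ∀ᶠ κ in atTop, c ≤ θ κ) : Tendsto η atTop atTop := by
  refine tendsto_atTop.2 fun b => ?_
  have hb : 0 < c / (|b| + 1) := by positivity
  filter_upwards [isLittleO_iff.1 h hb, hθ] with κ h_le hc_le
  rw [Real.norm_of_nonneg (hη κ), Real.norm_of_nonneg (hc.le.trans hc_le)] at h_le
  have h_mul : c * (|b| + 1) ≤ c * η κ := by
    rw [← le_div_iff₀ (by positivity), ← div_mul_eq_mul_div]
    exact hc_le.trans h_le
  linarith [le_of_mul_le_mul_left h_mul hc, le_abs_self b]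

theorem exists_negligible_of_gapBound {Q n : ℕ → ℕ} {ε d η : ℕ → ℝ} (hη : Tendsto η atTop atTop)
    (hn : PolyBounded n) (hQ : PolyBounded Q) (hε : Negligible ε)
    (h : ∀ κ, GapBound κ (Q κ) (n κ) (ε κ) (d κ) (η κ)) :
    ∃ ν : ℕ → ℝ, Negligible ν ∧ ∀ κ, d κ ≥ 1 - ν κ := by
  refine ⟨_, ((negligible_rpow_neg hη).polyBounded_sq_mul hQ).add
      (((hε.polyBounded_mul hn).sqrt.polyBounded_sq_mul hQ).const_mul 4), fun κ => ?_⟩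
  have h_gap := h κ
  rw [GapBound, mul_comm (ε κ)] at h_gap
  rw [Pi.add_apply]
  linarith

end Negligible

end

theorem mainTheorem1 :
    ∃ C : ℝ, 0 < C ∧
      ∀ (P : ZeroBitCode) (ρ : ℕ → unitInterval) (δ ε μ : ℕ → ℝ) (Q : ℕ → ℕ),
        P.IsPRC ρ δ ε μ → (∀ κ, 1 ≤ Q κ) → P.QueriesAtMost Q →
        (∃ η : ℕ → ℝ, (∀ κ, 0 ≤ η κ) ∧
          (fun κ => 1 - (ρ κ : ℝ)) =o[atTop] η ∧
          ∀ κ : ℕ, δ κ + μ κ ≥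
            1 - (Q κ : ℝ) ^ 2 * (κ : ℝ) ^ (-η κ)
              - C * ((Q κ : ℝ) ^ 2 * Real.sqrt (ε κ * (P.blockLen κ : ℝ)))) ∧
        (PolyBounded P.blockLen → PolyBounded Q → Negligible ε →
          (∃ r : ℝ, r < 1 ∧ ∀ᶠ κ in atTop, (ρ κ : ℝ) ≤ r) →
          ∃ ν : ℕ → ℝ, Negligible ν ∧ ∀ κ, δ κ + μ κ ≥ 1 - ν κ) := by
  refine ⟨4, by norm_num, fun P ρ δ ε μ Q hP hQ hPQ => ?_⟩
  obtain ⟨η, hη_nonneg, hη_littleO, hη⟩ := hP.exists_exponent hQ hPQ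
  refine ⟨⟨η, hη_nonneg, hη_littleO, hη⟩, fun hn hQ_poly hε ⟨r, hr, hρ⟩ => ?_⟩
  have hη_tendsto : Tendsto η atTop atTop := tendsto_atTop_of_isLittleO hη_nonneg hη_littleO
    (sub_pos.2 hr) (hρ.mono fun κ h => sub_le_sub_left h 1)
  exact exists_negligible_of_gapBound hη_tendsto hn hQ_poly hε hη
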